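/- Let $d\ge 1$ and let $\mathcal X_d=\{\langle k,i\rangle : k\ge 0,\ 1\le i\le d\}$, where $k$ is called the level and $i$ the phase of the type $\langle k,i\rangle$. Consider a multitype Galton--Watson process with type set $\mathcal X_d$, in which all individuals reproduce independently and an individual of type $j$ has offspring vector $\boldsymbol r\in\mathbb N_0^{\mathcal X_d}$ with probability $p_j(\boldsymbol r)$. Assume that the process is block lower Hessenberg: individuals in level $k$ have no offspring in levels larger than $k+1$. Let $G_j(\boldsymbol s)=\sum_{\boldsymbol r}p_j(\boldsymbol r)\prod_i s_i^{r_i}$ be its progeny generating functions, and let $M(i,j)\in[0,\infty]$ be the mean number of type-$j$ children of a type-$i$ individual. The process is irreducible if the directed graph on $\mathcal X_d$ with an edge from $i$ to $j$ whenever $M(i,j)>0$ has a path between any two vertices. It is singular if each individual has exactly one child with probability one. For $A\subseteq\mathcal X_d$, let $q_i(A)$ be the probability, starting from one individual of type $i$, that from some generation on no individual with type in $A$ appears, and let $\boldsymbol q(A)=(q_i(A))_{i\in\mathcal X_d}$. Let $T_k$ be the set of types of level at most $k$, and write $\overline B=\mathcal X_d\setminus B$. Let $\tilde{\boldsymbol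 q}=(\tilde q_i)$, where $\tilde q_i$ is the probability, starting from one individual of type $i$, that for every $u$ no individual with type in $T_u$ appears from some generation on (partial extinction). For $k,\ell\ge0$, let $q_i^{(k,\ell)}(A)$ be the probability, starting from one individual of type $i$, that the process in which all individuals with type in $\overline A\cap\overline T_\ell$ are made sterile becomes extinct without ever containing an individual with type in $A\cap\overline T_k$. Let $\boldsymbol G^{(k,\ell)}(A)$ be the vector of functions $$G^{(k,\ell)}_i(A)(\boldsymbol s)=\begin{cases}0,& i\in A\cap\overline T_k,\\ 1,& i\in\overline A\cap\overline T_\ell,\\ G_i(\boldsymbol s),&\text{otherwise,}\end{cases}$$ that is, types in $A$ above level $k$ are immortal and types outside $A$ above level $\ell$ have no offspring. Theorem. Suppose that the process is irreducible, that $A\subseteq\mathcal X_d$ is non-empty, and that $A$ is infinite, or the process is not singular, or $\tilde{\boldsymbol q}=\boldsymbol 1$. Then, for all $k,\ell\ge0$, the vector $\boldsymbol q^{(k,\ell)}(A)$ is the extinction probability vector associated with $\boldsymbol G^{(k,\ell)}(A)$, that is, the entrywise limit as $n\to\infty$ of the $n$-fold iterates of $\boldsymbol G^{(k,\ell)}(A)$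 at $\boldsymbol 0$. For every $k$ the entrywise limit $\lim_{\ell\to\infty}\boldsymbol q^{(k,\ell)}(A)$ exists, and $$\lim_{k\to\infty}\lim_{\ell\to\infty}\boldsymbol q^{(k,\ell)}(A)=\boldsymbol q(A)\quad\text{entrywise.}$$ -/

import Mathlib

open Filter Topology MeasureTheory

noncomputable section

/-- The type set `{⟨k, i⟩ : k ≥ 0, 1 ≤ i ≤ d}`; the first entry is the level, the second
(an element of `Fin d`) is the phase. -/
abbrev TypeSet (d : ℕ) : Type := ℕ × Fin d

/-- Offspring vectors. A vector supported on finitely many levels has finite support, as each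
level contains only `d` types. -/
abbrev OffspringVector (d : ℕ) : Type := TypeSet d →₀ ℕ

instance offspringMeasurableSpace (d : ℕ) : MeasurableSpace (OffspringVector d) := ⊤

/-- A block lower Hessenberg branching process, given by its offspring distributions `p_j`:
an individual in level `k` has no offspring in a level larger than `k + 1`. -/
structure BlockLHBP (d : ℕ) where
  p : TypeSet d → PMF (OffspringVector d)
  hessenberg : ∀ (j : TypeSet d) (r : OffspringVector d), r ∈ (p j).support →
    ∀ i : TypeSet d, j.1 + 1 < i.1 → r i = 0

/-- Virtual individuals: the type of the root, together with the list of pairs (number, type)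
that describe the line of descent, most recent birth first. -/
abbrev Individual (d : ℕ) : Type := TypeSet d × List (ℕ × TypeSet d)

/-- The type of a virtual individual. -/
def Individual.type {d : ℕ} : Individual d → TypeSet d
  | (φ, []) => φ
  | (_, (_, j) :: _) => j

/-- An outcome assigns an offspring vector to every virtual individual. -/
abbrev Outcome (d : ℕ) : Type := Individual d → OffspringVector d

/-- The random set of individuals that appear in generation `n`, if the root has type `φ`. The
children of type `j` of an individual `x` are numbered `0, 1, …, N_j(x) - 1`. -/
def generation {d : ℕ} (N : Outcome d) (φ : TypeSet d) : ℕ → Set (Individual d)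
  | 0 => {(φ, [])}
  | n + 1 => {y | ∃ x ∈ generation N φ n, ∃ (i : ℕ) (j : TypeSet d),
      i < N x j ∧ y = (x.1, (i, j) :: x.2)}

/-- `Z_{n,j}`: the number of individuals of type `j` in generation `n`. -/
def popCount {d : ℕ} (N : Outcome d) (φ : TypeSet d) (n : ℕ) (j : TypeSet d) : ℕ∞ :=
  {x | x ∈ generation N φ n ∧ Individual.type x = j}.encard

/-- `E_n(A)`: no individual with type in `A` appears from generation `n` on. -/
def noneFrom {d : ℕ} (φ : TypeSet d) (A : Set (TypeSet d)) (n : ℕ) : Set (Outcome d) :=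
  {N | ∀ m, n ≤ m → ∀ j ∈ A, popCount N φ m j = 0}

/-- `E(A)`: eventual extinction in `A`. -/
def extinction {d : ℕ} (φ : TypeSet d) (A : Set (TypeSet d)) : Set (Outcome d) :=
  ⋃ n, noneFrom φ A n

open Classical in
/-- The outcome in which all individuals with type outside `B` are made sterile. -/
def sterilize {d : ℕ} (B : Set (TypeSet d)) (N : Outcome d) : Outcome d :=
  fun x => if Individual.type x ∈ B then N x else 0

/-- `T_k`: the types whose level is at most `k`. -/
def levelsUpTo (d k : ℕ) : Set (TypeSet d) := {i | i.1 ≤ k}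

namespace BlockLHBP

variable {d : ℕ}

/-- The probability measure on outcomes: the offspring vectors of the virtual individuals are
independent, and that of an individual of type `j` has distribution `p_j`. -/
def prob (P : BlockLHBP d) : Measure (Outcome d) :=
  Measure.infinitePi fun x : Individual d => (P.p (Individual.type x)).toMeasure

/-- The extinction probability vector `q(A)`. -/
def q (P : BlockLHBP d) (A : Set (TypeSet d)) : TypeSet d → ℝ :=
  fun i => P.prob.real (extinction i A)

/-- The partial extinction probability vector: the probability of extinction in every `T_u`. -/
def qPartial (P : BlockLHBP d) : TypeSet d → ℝ :=
  fun i => P.prob.real (⋂ u : ℕ, extinction i (levelsUpTo d u))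

/-- The process is singular if each individual has exactly one child with probability one. -/
def Singular (P : BlockLHBP d) : Prop :=
  ∀ (j : TypeSet d) (r : OffspringVector d), r ∈ (P.p j).support → (r.sum fun _ m => m) = 1

/-- The progeny generating function `G`. -/
def G (P : BlockLHBP d) (s : TypeSet d → ℝ) : TypeSet d → ℝ :=
  fun j => ∑' r : OffspringVector d, (P.p j r).toReal * r.prod fun i m => s i ^ m

/-- The mean progeny matrix `M`; entries may be infinite. -/
def M (P : BlockLHBP d) (i j : TypeSet d) : ENNReal :=
  ∑' r : OffspringVector d, P.p i r * (r j : ENNReal)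

/-- In the mean progeny representation graph, there is a path between any two vertices. -/
def Irreducible (P : BlockLHBP d) : Prop :=
  ∀ i j : TypeSet d, Relation.ReflTransGen (fun a b => 0 < P.M a b) i j

open Classical in
/-- The progeny generating vector `G^{(k,ℓ)}(A)` of the truncated process: types in `A` above
level `k` are immortal, types outside `A` above level `ℓ` are sterile. -/
def truncG (P : BlockLHBP d) (A : Set (TypeSet d)) (k l : ℕ) (s : TypeSet d → ℝ) :
    TypeSet d → ℝ :=
  fun i => if i ∈ A ∩ (levelsUpTo d k)ᶜ then 0
    else if i ∈ Aᶜ ∩ (levelsUpTo d l)ᶜ then 1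
    else P.G s i

/-- The extinction probability vector `q^{(k,ℓ)}(A)` of the truncated process: the probability
that the process in which the types outside `A ∪ T_ℓ` are sterile becomes extinct without ever
producing an (immortal) individual with type in `A` above level `k`. -/
def truncQ (P : BlockLHBP d) (A : Set (TypeSet d)) (k l : ℕ) : TypeSet d → ℝ :=
  fun i => P.prob.real
    {N | sterilize (A ∪ levelsUpTo d l) N ∈
      extinction i Set.univ ∩ noneFrom i (A ∩ (levelsUpTo d k)ᶜ) 0}

end BlockLHBP

end

/-! Put `C_l = A ∪ T_l` (fertile types) and `I_k = A ∩ T_kᶜ` (immortal types). Splitting at the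
first generation shows that the `n`-th iterate of the truncated generating function at `0` is the
probability that the process with fertile types `C_l` dies before generation `n` without meeting
`I_k`. These events increase in `n`, and their union defines `q^(k,l)(A)`. This union decreases in
`l` and increases in `k`, so both limits follow from continuity of measure once `ae_not_recurs_iff`
is known: almost surely, `A` dies out iff for some `k` the truncated event occurs for all `l`.

If `A` dies out, only finitely many individuals have type in `A`, so their levels are bounded by
some `k`. Survival with fertile types `C_l` would make some type of the finite set `T_l` recurrent,
and by Lévy's zero-one law and irreducibility every type of `A` would recur as well.

Conversely, suppose that `I_k` is never met but `A` recurs. Then a single type `j` of level at most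
`k` recurs. If `A` is infinite, so does a type of `I_k`, a contradiction; if partial extinction is
almost sure, this has probability zero. If the process is not singular, recurrence of `j` forces
survival inside some `T_l`, against extinction of the truncated process. Indeed, the first returns
to `j` form a Galton-Watson process. If its mean exceeds one, finitely many lines of first return
already carry a mean above one, and a second moment estimate gives survival within their levels
(`exists_survivesIn_of_one_lt`). If its mean is at most one, recurrence forces exactly one first
return (`unique_firstReturn_of_recurs`), which irreducibility turns into singularity
(`singular_of_unique_firstReturn`). -/

noncomputable section

namespace BlockLHBP

variable {d : ℕ}

/-! ### Lines of descent in a tree; ancestors are suffixes. -/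

/-- Lines of descent, most recent birth first. -/
abbrev Line (d : ℕ) : Type := List (ℕ × TypeSet d)

/-- The offspring vectors of the virtual descendants of a root of unspecified type. -/
abbrev Tree (d : ℕ) : Type := Line d → OffspringVector d

instance : DiscreteMeasurableSpace (OffspringVector d) := ⟨fun _ => trivial⟩

/-- The type of the virtual descendant `w` of a root of type `φ`. -/
def lineType (φ : TypeSet d) (w : Line d) : TypeSet d := Individual.type (φ, w)

@[simp] lemma lineType_nil (φ : TypeSet d) : lineType φ [] = φ := rfl

@[simp] lemma lineType_cons (φ : TypeSet d) (c : ℕ × TypeSet d) (w : Line d) :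
    lineType φ (c :: w) = c.2 := rfl

lemma lineType_append (φ : TypeSet d) (u w : Line d) :
    lineType φ (u ++ w) = lineType (lineType φ w) u := by
  cases u <;> rfl

/-- The tree of descendants of the virtual individual `w`. -/
def shift (w : Line d) (ω : Tree d) : Tree d := fun u => ω (u ++ w)

@[simp] lemma shift_apply (w u : Line d) (ω : Tree d) : shift w ω u = ω (u ++ w) := rfl

@[fun_prop]
lemma measurable_shift (w : Line d) : Measurable (shift w : Tree d → Tree d) := by
  unfold shift
  fun_prop

/-- The virtual individual `w` appears, in the process where only types in `C` are fertile. -/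
def AliveIn (C : Set (TypeSet d)) (φ : TypeSet d) (ω : Tree d) : Line d → Prop
  | [] => True
  | c :: w => AliveIn C φ ω w ∧ lineType φ w ∈ C ∧ c.1 < ω w c.2

/-- The virtual individual `w` appears. -/
def Alive (ω : Tree d) : Line d → Prop
  | [] => True
  | c :: w => Alive ω w ∧ c.1 < ω w c.2

@[simp] lemma alive_nil (ω : Tree d) : Alive ω [] := trivial

@[simp] lemma alive_cons (ω : Tree d) (c : ℕ × TypeSet d) (w : Line d) :
    Alive ω (c :: w) ↔ Alive ω w ∧ c.1 < ω w c.2 := Iff.rfl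

@[simp] lemma aliveIn_nil (C : Set (TypeSet d)) (φ : TypeSet d) (ω : Tree d) :
    AliveIn C φ ω [] := trivial

@[simp] lemma aliveIn_cons (C : Set (TypeSet d)) (φ : TypeSet d) (ω : Tree d)
    (c : ℕ × TypeSet d) (w : Line d) :
    AliveIn C φ ω (c :: w) ↔ AliveIn C φ ω w ∧ lineType φ w ∈ C ∧ c.1 < ω w c.2 := Iff.rfl

lemma alive_append (ω : Tree d) (u w : Line d) :
    Alive ω (u ++ w) ↔ Alive ω w ∧ Alive (shift w ω) u := by
  induction u with
  | nil => simp
  | cons c u ih => simp [ih, and_assoc]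

lemma aliveIn_append (C : Set (TypeSet d)) (φ : TypeSet d) (ω : Tree d) (u w : Line d) :
    AliveIn C φ ω (u ++ w) ↔ AliveIn C φ ω w ∧ AliveIn C (lineType φ w) (shift w ω) u := by
  induction u with
  | nil => simp
  | cons c u ih => simp [ih, and_assoc, lineType_append]

lemma AliveIn.alive {C : Set (TypeSet d)} {φ : TypeSet d} {ω : Tree d} {w : Line d}
    (h : AliveIn C φ ω w) : Alive ω w := by
  induction w with
  | nil => trivial
  | cons c w ih => exact ⟨ih h.1, h.2.2⟩

lemma AliveIn.mono {C D : Set (TypeSet d)} (hCD : C ⊆ D) {φ : TypeSet d} {ω : Tree d} {w : Line d}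
    (h : AliveIn C φ ω w) : AliveIn D φ ω w := by
  induction w with
  | nil => trivial
  | cons c w ih => exact ⟨ih h.1, hCD h.2.1, h.2.2⟩

/-- Only finitely many levels occur on a line of descent. -/
lemma exists_aliveIn_levelsUpTo (φ : TypeSet d) (w : Line d) :
    ∃ l, ∀ ω : Tree d, Alive ω w → AliveIn (levelsUpTo d l) φ ω w := by
  induction w with
  | nil => exact ⟨0, fun _ _ => trivial⟩
  | cons c w ih =>
    obtain ⟨l, hl⟩ := ih
    refine ⟨max l (lineType φ w).1, fun ω h => ⟨(hl ω h.1).mono ?_, ?_, h.2⟩⟩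
    · intro i hi
      exact (show i.1 ≤ l from hi).trans (le_max_left _ _)
    · exact le_max_right l _

lemma levelsUpTo_mono {k l : ℕ} (h : k ≤ l) : levelsUpTo d k ⊆ levelsUpTo d l :=
  fun _ hi => le_trans hi h

lemma finite_levelsUpTo (k : ℕ) : (levelsUpTo d k).Finite := by
  have : levelsUpTo d k = Set.Iic k ×ˢ Set.univ := by
    ext i
    simp [levelsUpTo]
  rw [this]
  exact (Set.finite_Iic k).prod Set.finite_univ

lemma measurableSet_eval (w : Line d) (s : Set (OffspringVector d)) :
    MeasurableSet {ω : Tree d | ω w ∈ s} :=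
  measurable_pi_apply w (MeasurableSet.of_discrete (s := s))

lemma measurableSet_alive (w : Line d) : MeasurableSet {ω : Tree d | Alive ω w} := by
  induction w with
  | nil => simp
  | cons c w ih =>
    exact ih.inter (measurableSet_eval w {r | c.1 < r c.2})

lemma measurableSet_aliveIn (C : Set (TypeSet d)) (φ : TypeSet d) (w : Line d) :
    MeasurableSet {ω : Tree d | AliveIn C φ ω w} := by
  induction w with
  | nil => simp
  | cons c w ih =>
    exact ih.inter ((MeasurableSet.const _).inter
      (measurableSet_eval w {r | c.1 < r c.2}))

/-! ### The law of the tree and the branching property. -/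

/-- The law of the tree of descendants of an individual of type `φ`. -/
def law (P : BlockLHBP d) (φ : TypeSet d) : Measure (Tree d) :=
  Measure.infinitePi fun w : Line d => (P.p (lineType φ w)).toMeasure

instance (P : BlockLHBP d) (φ : TypeSet d) : IsProbabilityMeasure (P.law φ) := by
  unfold law
  infer_instance

lemma map_prob (P : BlockLHBP d) (φ : TypeSet d) :
    P.prob.map (fun N w => N (φ, w)) = P.law φ :=
  Measure.map_infinitePi_infinitePi_of_inj
    (P := fun x : Individual d => (P.p (Individual.type x)).toMeasure)
    (f := fun w : Line d => ((φ, w) : Individual d)) fun _ _ h => (Prod.ext_iff.1 h).2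

lemma prob_real_preimage (P : BlockLHBP d) (φ : TypeSet d) {s : Set (Tree d)}
    (hs : MeasurableSet s) :
    P.prob.real ((fun N w => N (φ, w)) ⁻¹' s) = (P.law φ).real s := by
  rw [← map_prob, map_measureReal_apply (by fun_prop) hs]

lemma map_shift (P : BlockLHBP d) (φ : TypeSet d) (w : Line d) :
    (P.law φ).map (shift w) = P.law (lineType φ w) := by
  have := Measure.map_infinitePi_infinitePi_of_inj
    (P := fun u : Line d => (P.p (lineType φ u)).toMeasure)
    (f := fun u : Line d => u ++ w) fun _ _ h => List.append_cancel_right h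
  simp only [lineType_append] at this
  exact this

lemma map_root (P : BlockLHBP d) (φ : TypeSet d) :
    (P.law φ).map (fun ω => ω []) = (P.p φ).toMeasure :=
  Measure.infinitePi_map_eval (fun u : Line d => (P.p (lineType φ u)).toMeasure) []

/-- The events that depend only on the offspring vectors of the individuals in `S`. -/
@[reducible]
def sigmaOf (S : Set (Line d)) : MeasurableSpace (Tree d) :=
  ⨆ u ∈ S, MeasurableSpace.comap (fun ω : Tree d => ω u) ⊤

lemma sigmaOf_mono {S T : Set (Line d)} (h : S ⊆ T) :
    (sigmaOf S : MeasurableSpace (Tree d)) ≤ sigmaOf T :=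
  biSup_mono h

lemma sigmaOf_le (S : Set (Line d)) : sigmaOf S ≤ (inferInstance : MeasurableSpace (Tree d)) :=
  iSup₂_le fun u _ => (measurable_pi_apply u).comap_le

lemma sigmaOf_univ : sigmaOf Set.univ = (inferInstance : MeasurableSpace (Tree d)) := by
  simp only [sigmaOf, Set.mem_univ, iSup_pos]
  rfl

lemma measurableSet_sigmaOf_eval {S : Set (Line d)} {u : Line d} (hu : u ∈ S)
    (s : Set (OffspringVector d)) : MeasurableSet[sigmaOf S] {ω : Tree d | ω u ∈ s} :=
  (le_iSup₂ (f := fun u (_ : u ∈ S) => MeasurableSpace.comap (fun ω : Tree d => ω u) ⊤) u hu) _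
    ⟨s, trivial, rfl⟩

/-- Whether `w` appears is decided by its strict ancestors alone, so it is independent of the tree
rooted at `w`. -/
lemma measurableSet_sigmaOf_alive {S : Set (Line d)} {w : Line d}
    (hw : ∀ u, u <:+ w → u ≠ w → u ∈ S) : MeasurableSet[sigmaOf S] {ω : Tree d | Alive ω w} := by
  induction w with
  | nil => simp
  | cons c w ih =>
    refine (ih fun u hu _ => hw u (hu.trans (List.suffix_cons c w)) ?_).inter
      (measurableSet_sigmaOf_eval (hw w (List.suffix_cons c w) (by simp)) {r | c.1 < r c.2})
    rintro rfl
    simpa using hu.length_le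

lemma measurable_shift_sigmaOf (w : Line d) :
    Measurable[sigmaOf {u | w <:+ u}] (shift w : Tree d → Tree d) := by
  refine @measurable_pi_lambda _ _ _ (sigmaOf {u | w <:+ u}) _ _ fun u => ?_
  intro s _
  exact measurableSet_sigmaOf_eval (List.suffix_append u w) s

lemma indep_sigmaOf (P : BlockLHBP d) (φ : TypeSet d) {S T : Set (Line d)} (h : Disjoint S T) :
    ProbabilityTheory.Indep (sigmaOf S) (sigmaOf T) (P.law φ) := by
  refine ProbabilityTheory.indep_iSup_of_disjoint
    (fun u => (measurable_pi_apply u).comap_le) ?_ h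
  rw [← ProbabilityTheory.iIndepFun_iff_iIndep]
  exact ProbabilityTheory.iIndepFun_infinitePi
    (P := fun u : Line d => (P.p (lineType φ u)).toMeasure) (X := fun _ r => r)
    fun _ => measurable_id

/-- The branching property. -/
lemma law_inter_shift (P : BlockLHBP d) (φ : TypeSet d) {S : Set (Line d)} {w : Line d}
    (hS : ∀ u ∈ S, ¬ w <:+ u) {E H : Set (Tree d)} (hE : MeasurableSet[sigmaOf S] E)
    (hH : MeasurableSet H) :
    P.law φ (E ∩ shift w ⁻¹' H) = P.law φ E * P.law (lineType φ w) H := by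
  have hdis : Disjoint S {u | w <:+ u} := Set.disjoint_left.2 hS
  rw [(ProbabilityTheory.Indep_iff _ _ _).1 (P.indep_sigmaOf φ hdis) _ _ hE
    (measurable_shift_sigmaOf w hH),
    ← map_shift, Measure.map_apply (measurable_shift w) hH]

lemma law_alive_inter_shift (P : BlockLHBP d) (φ : TypeSet d) (w : Line d) {H : Set (Tree d)}
    (hH : MeasurableSet H) :
    P.law φ ({ω | Alive ω w} ∩ shift w ⁻¹' H) =
      P.law φ {ω | Alive ω w} * P.law (lineType φ w) H := by
  refine P.law_inter_shift φ (S := {u | ¬ w <:+ u}) (fun _ h => h)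
    (measurableSet_sigmaOf_alive fun u hu hne hw => hne ?_) hH
  exact hu.eq_of_length_le hw.length_le

/-! ### Extinction events in terms of lines of descent. -/

lemma mem_generation_iff (N : Outcome d) (φ : TypeSet d) (n : ℕ) (x : Individual d) :
    x ∈ generation N φ n ↔ x.1 = φ ∧ x.2.length = n ∧ Alive (fun w => N (φ, w)) x.2 := by
  induction n generalizing x with
  | zero =>
    obtain ⟨i, w⟩ := x
    simp only [generation, Set.mem_singleton_iff, Prod.mk.injEq, List.length_eq_zero_iff]
    constructor
    · rintro ⟨rfl, rfl⟩
      simp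
    · rintro ⟨rfl, rfl, -⟩
      simp
  | succ n ih =>
    simp only [generation, Set.mem_ofPred_eq]
    constructor
    · rintro ⟨y, hy, i, j, hij, rfl⟩
      obtain ⟨rfl, hl, ha⟩ := (ih y).1 hy
      exact ⟨rfl, by simp [hl], ha, hij⟩
    · rintro ⟨rfl, hl, ha⟩
      obtain ⟨i, w⟩ := x
      cases w with
      | nil => simp at hl
      | cons c w =>
        exact ⟨(i, w), (ih _).2 ⟨rfl, by simpa using hl, ha.1⟩, c.1, c.2, ha.2, rfl⟩

lemma mem_noneFrom_iff (N : Outcome d) (φ : TypeSet d) (A : Set (TypeSet d)) (n : ℕ) :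
    N ∈ noneFrom φ A n ↔
      ∀ w : Line d, n ≤ w.length → Alive (fun u => N (φ, u)) w → lineType φ w ∉ A := by
  simp only [noneFrom, Set.mem_ofPred_eq, popCount, Set.encard_eq_zero,
    Set.eq_empty_iff_forall_notMem, mem_generation_iff]
  constructor
  · intro h w hn hw hA
    exact h _ hn _ hA (φ, w) ⟨⟨rfl, rfl, hw⟩, rfl⟩
  · rintro h m hm j hj ⟨i, w⟩ ⟨⟨rfl, rfl, hw⟩, rfl⟩
    exact h w hm hw hj

lemma alive_sterilize_iff (C : Set (TypeSet d)) (N : Outcome d) (φ : TypeSet d) (w : Line d) :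
    Alive (fun u => sterilize C N (φ, u)) w ↔ AliveIn C φ (fun u => N (φ, u)) w := by
  classical
  induction w with
  | nil => simp
  | cons c w ih =>
    rw [alive_cons, aliveIn_cons, ih]
    by_cases h : lineType φ w ∈ C
    · simp [sterilize, show Individual.type (φ, w) ∈ C from h, h]
    · simp [sterilize, show Individual.type (φ, w) ∉ C from h, h]

/-- Types in `B` are visited at arbitrarily late generations. -/
def Recurs (B : Set (TypeSet d)) (φ : TypeSet d) (ω : Tree d) : Prop :=
  ∀ n, ∃ w : Line d, n ≤ w.length ∧ Alive ω w ∧ lineType φ w ∈ B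

/-- The process where only types in `C` are fertile survives. -/
def SurvivesIn (C : Set (TypeSet d)) (φ : TypeSet d) (ω : Tree d) : Prop :=
  ∀ n, ∃ w : Line d, n ≤ w.length ∧ AliveIn C φ ω w

lemma mem_extinction_iff (N : Outcome d) (φ : TypeSet d) (A : Set (TypeSet d)) :
    N ∈ extinction φ A ↔ ¬ Recurs A φ (fun u => N (φ, u)) := by
  simp [extinction, mem_noneFrom_iff, Recurs]

lemma measurableSet_lineType_alive (A : Set (TypeSet d)) (φ : TypeSet d) (w : Line d) :
    MeasurableSet {ω : Tree d | Alive ω w ∧ lineType φ w ∈ A} :=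
  (measurableSet_alive w).inter (MeasurableSet.const _)

lemma measurableSet_recurs (B : Set (TypeSet d)) (φ : TypeSet d) :
    MeasurableSet {ω : Tree d | Recurs B φ ω} := by
  simp only [Recurs, Set.ofPred_forall, Set.ofPred_exists]
  exact .iInter fun n => .iUnion fun w => (MeasurableSet.const _).inter
    (measurableSet_lineType_alive B φ w)

lemma measurableSet_survivesIn (C : Set (TypeSet d)) (φ : TypeSet d) :
    MeasurableSet {ω : Tree d | SurvivesIn C φ ω} := by
  simp only [SurvivesIn, Set.ofPred_forall, Set.ofPred_exists]
  exact .iInter fun n => .iUnion fun w => (MeasurableSet.const _).inter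
    (measurableSet_aliveIn C φ w)

/-- No type in `I` appears in the process where only types in `C` are fertile. -/
def Avoids (C I : Set (TypeSet d)) (φ : TypeSet d) (ω : Tree d) : Prop :=
  ∀ w : Line d, AliveIn C φ ω w → lineType φ w ∉ I

lemma measurableSet_avoids (C I : Set (TypeSet d)) (φ : TypeSet d) :
    MeasurableSet {ω : Tree d | Avoids C I φ ω} := by
  simp only [Avoids, Set.ofPred_forall]
  refine .iInter fun w => ?_
  have : {ω : Tree d | AliveIn C φ ω w → lineType φ w ∉ I} =
      {ω | AliveIn C φ ω w}ᶜ ∪ {_ω | lineType φ w ∉ I} := by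
    ext ω
    simp only [Set.mem_ofPred_eq, Set.mem_union, Set.mem_compl_iff, imp_iff_not_or]
  rw [this]
  exact (measurableSet_aliveIn C φ w).compl.union (MeasurableSet.const _)

lemma q_eq (P : BlockLHBP d) (A : Set (TypeSet d)) (φ : TypeSet d) :
    P.q A φ = (P.law φ).real {ω | ¬ Recurs A φ ω} := by
  rw [← prob_real_preimage P φ (s := {ω | ¬ Recurs A φ ω}) (measurableSet_recurs A φ).compl, q]
  congr 1
  ext N
  exact mem_extinction_iff N φ A

lemma qPartial_eq (P : BlockLHBP d) (φ : TypeSet d) :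
    P.qPartial φ = (P.law φ).real {ω | ∀ u, ¬ Recurs (levelsUpTo d u) φ ω} := by
  rw [← prob_real_preimage P φ (s := {ω | ∀ u, ¬ Recurs (levelsUpTo d u) φ ω}), qPartial]
  · congr 1
    ext N
    simp [mem_extinction_iff]
  · simp only [Set.ofPred_forall]
    exact .iInter fun u => (measurableSet_recurs _ φ).compl

/-- Extinction without a visit to `I`, in the process where only types in `C` are fertile. -/
def truncEvent (C I : Set (TypeSet d)) (φ : TypeSet d) : Set (Tree d) :=
  {ω | ¬ SurvivesIn C φ ω ∧ Avoids C I φ ω}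

lemma measurableSet_truncEvent (C I : Set (TypeSet d)) (φ : TypeSet d) :
    MeasurableSet (truncEvent C I φ) :=
  (measurableSet_survivesIn C φ).compl.inter (measurableSet_avoids C I φ)

lemma truncQ_eq (P : BlockLHBP d) (A : Set (TypeSet d)) (k l : ℕ) (φ : TypeSet d) :
    P.truncQ A k l φ =
      (P.law φ).real (truncEvent (A ∪ levelsUpTo d l) (A ∩ (levelsUpTo d k)ᶜ) φ) := by
  rw [← prob_real_preimage P φ (measurableSet_truncEvent _ _ φ), truncQ]
  congr 1
  ext N
  simp [truncEvent, extinction, mem_noneFrom_iff, alive_sterilize_iff, SurvivesIn, Avoids]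

/-! ### Iterates of the truncated generating function. -/

/-- Extinction before generation `n` without a visit to `I`, in the process where only types in
`C` are fertile. -/
def truncEventBefore (C I : Set (TypeSet d)) (n : ℕ) (φ : TypeSet d) : Set (Tree d) :=
  {ω | ∀ w : Line d, AliveIn C φ ω w → w.length < n ∧ lineType φ w ∉ I}

lemma measurableSet_truncEventBefore (C I : Set (TypeSet d)) (n : ℕ) (φ : TypeSet d) :
    MeasurableSet (truncEventBefore C I n φ) := by
  simp only [truncEventBefore, Set.ofPred_forall]
  refine .iInter fun w => ?_
  have : {ω : Tree d | AliveIn C φ ω w → w.length < n ∧ lineType φ w ∉ I} =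
      {ω | AliveIn C φ ω w}ᶜ ∪ {_ω | w.length < n ∧ lineType φ w ∉ I} := by
    ext ω
    simp only [Set.mem_ofPred_eq, Set.mem_union, Set.mem_compl_iff, imp_iff_not_or]
  rw [this]
  exact (measurableSet_aliveIn C φ w).compl.union (MeasurableSet.const _)

lemma monotone_truncEventBefore (C I : Set (TypeSet d)) (φ : TypeSet d) :
    Monotone fun n => truncEventBefore C I n φ :=
  fun _ _ hmn _ hω w hw => ⟨(hω w hw).1.trans_le hmn, (hω w hw).2⟩

lemma iUnion_truncEventBefore (C I : Set (TypeSet d)) (φ : TypeSet d) :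
    ⋃ n, truncEventBefore C I n φ = truncEvent C I φ := by
  ext ω
  simp only [truncEventBefore, truncEvent, SurvivesIn, Avoids, Set.mem_iUnion, Set.mem_ofPred_eq,
    not_forall, not_exists, not_and]
  constructor
  · rintro ⟨n, hn⟩
    exact ⟨⟨n, fun w hw ha => hw.not_gt (hn w ha).1⟩, fun w ha => (hn w ha).2⟩
  · rintro ⟨⟨n, hn⟩, h⟩
    exact ⟨n, fun w ha => ⟨not_le.1 fun hw => hn w hw ha, h w ha⟩⟩

/-- The labels of the children described by an offspring vector. -/
def children (r : OffspringVector d) : Finset (ℕ × TypeSet d) :=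
  r.support.biUnion fun j => Finset.range (r j) ×ˢ {j}

lemma mem_children {r : OffspringVector d} {c : ℕ × TypeSet d} :
    c ∈ children r ↔ c.1 < r c.2 := by
  simp only [children, Finset.mem_biUnion, Finset.mem_product, Finset.mem_range,
    Finset.mem_singleton, Finsupp.mem_support_iff]
  constructor
  · rintro ⟨j, -, h, rfl⟩
    exact h
  · intro h
    exact ⟨c.2, by omega, h, rfl⟩

lemma prod_children {R : Type*} [CommMonoid R] (r : OffspringVector d) (f : TypeSet d → R) :
    ∏ c ∈ children r, f c.2 = r.prod fun j m => f j ^ m := by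
  rw [Finset.prod_finset_product_right (children r) r.support fun j => Finset.range (r j)]
  · simp [Finsupp.prod]
  · intro c
    rw [mem_children, Finsupp.mem_support_iff, Finset.mem_range]
    omega

lemma card_children (r : OffspringVector d) : (children r).card = r.sum fun _ m => m := by
  rw [Finset.card_eq_sum_ones,
    Finset.sum_finset_product_right (children r) r.support fun j => Finset.range (r j)]
  · simp [Finsupp.sum]
  · intro c
    rw [mem_children, Finsupp.mem_support_iff, Finset.mem_range]
    omega

lemma law_root_eq (P : BlockLHBP d) (φ : TypeSet d) (r : OffspringVector d) :
    P.law φ {ω | ω [] = r} = P.p φ r := by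
  have hf : Measurable fun ω : Tree d => ω [] := by fun_prop
  rw [← PMF.toMeasure_apply_singleton (P.p φ) r (MeasurableSet.singleton r), ← map_root,
    Measure.map_apply hf (MeasurableSet.singleton r)]
  rfl

lemma law_root_inter_children (P : BlockLHBP d) (φ : TypeSet d) (r : OffspringVector d)
    (s : Finset (ℕ × TypeSet d)) {H : TypeSet d → Set (Tree d)} (hH : ∀ j, MeasurableSet (H j)) :
    P.law φ ({ω | ω [] = r} ∩ {ω | ∀ c ∈ s, shift [c] ω ∈ H c.2}) =
      P.p φ r * ∏ c ∈ s, P.law c.2 (H c.2) := by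
  classical
  induction s using Finset.induction_on with
  | empty => simp [law_root_eq]
  | insert a s ha ih =>
    have : {ω : Tree d | ω [] = r} ∩ {ω | ∀ c ∈ insert a s, shift [c] ω ∈ H c.2} =
        ({ω | ω [] = r} ∩ {ω | ∀ c ∈ s, shift [c] ω ∈ H c.2}) ∩ shift [a] ⁻¹' H a.2 := by
      ext ω
      simp only [Finset.forall_mem_insert, Set.mem_inter_iff, Set.mem_ofPred_eq, Set.mem_preimage]
      tauto
    rw [this, P.law_inter_shift φ (S := {u | ¬ [a] <:+ u}) (fun _ h => h) _ (hH _), ih,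
      Finset.prod_insert ha, lineType_cons]
    · ring
    -- The root and the trees of the children in `s` lie outside the tree of `a`, since lines
    -- through distinct children of the root are disjoint.
    · refine (measurableSet_sigmaOf_eval (by simp) {r}).inter ?_
      simp only [Set.ofPred_forall]
      refine MeasurableSet.biInter s.countable_toSet fun c hc => ?_
      refine sigmaOf_mono (S := {u | [c] <:+ u}) ?_ _ (measurable_shift_sigmaOf [c] (hH c.2))
      intro u hcu hau
      have h1 := (List.suffix_of_suffix_length_le hcu hau (by simp)).eq_of_length (by simp)
      exact ha (by simpa using (List.cons.inj h1).1 ▸ hc)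

lemma truncEventBefore_succ {C I : Set (TypeSet d)} (n : ℕ) {φ : TypeSet d} (hC : φ ∈ C)
    (hI : φ ∉ I) : truncEventBefore C I (n + 1) φ =
      {ω | ∀ c ∈ children (ω []), shift [c] ω ∈ truncEventBefore C I n c.2} := by
  ext ω
  constructor
  · intro h c hc w hw
    have := h (w ++ [c]) ((aliveIn_append C φ ω w [c]).2
      ⟨⟨trivial, hC, mem_children.1 hc⟩, hw⟩)
    simpa [lineType_append] using this
  · intro h w hw
    obtain rfl | ⟨u, c, rfl⟩ := List.eq_nil_or_concat' w
    · simpa using hI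
    · rw [aliveIn_append] at hw
      simpa [lineType_append] using h c (mem_children.2 hw.1.2.2) u hw.2

lemma law_forall_children (P : BlockLHBP d) (φ : TypeSet d) {H : TypeSet d → Set (Tree d)}
    (hH : ∀ j, MeasurableSet (H j)) :
    (P.law φ).real {ω | ∀ c ∈ children (ω []), shift [c] ω ∈ H c.2} =
      P.G (fun j => (P.law j).real (H j)) φ := by
  have hun : {ω : Tree d | ∀ c ∈ children (ω []), shift [c] ω ∈ H c.2} =
      ⋃ r : OffspringVector d, {ω | ω [] = r} ∩ {ω | ∀ c ∈ children r, shift [c] ω ∈ H c.2} := by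
    ext ω
    simp
  have hm : ∀ r : OffspringVector d, MeasurableSet
      ({ω : Tree d | ω [] = r} ∩ {ω | ∀ c ∈ children r, shift [c] ω ∈ H c.2}) := by
    intro r
    refine (measurableSet_eval [] {r}).inter ?_
    simp only [Set.ofPred_forall]
    exact MeasurableSet.biInter (children r).countable_toSet fun c _ => measurable_shift _ (hH c.2)
  have hd : Pairwise (Function.onFun Disjoint fun r : OffspringVector d =>
      {ω : Tree d | ω [] = r} ∩ {ω | ∀ c ∈ children r, shift [c] ω ∈ H c.2}) := by
    intro r r' hr
    refine Set.disjoint_left.2 ?_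
    rintro ω ⟨h1, -⟩ ⟨h2, -⟩
    exact hr (h1.symm.trans h2)
  rw [hun, Measure.real, measure_iUnion hd hm, ENNReal.tsum_toReal_eq fun _ => measure_ne_top _ _]
  refine tsum_congr fun r => ?_
  rw [law_root_inter_children P φ r _ hH, ENNReal.toReal_mul, ENNReal.toReal_prod]
  congr 1
  exact prod_children r fun j => (P.law j).real (H j)

/-- The root lives in generation `0`, so nothing is extinct before generation `0`; this matches the
starting vector `0`. An immortal root violates the event at once, a sterile one satisfies it from `n
= 1` on, and any other root passes the event to its independent children. -/
lemma truncG_iterate (P : BlockLHBP d) (A : Set (TypeSet d)) (k l n : ℕ) (φ : TypeSet d) :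
    (P.truncG A k l)^[n] 0 φ = (P.law φ).real
      (truncEventBefore (A ∪ levelsUpTo d l) (A ∩ (levelsUpTo d k)ᶜ) n φ) := by
  induction n generalizing φ with
  | zero =>
    have : truncEventBefore (A ∪ levelsUpTo d l) (A ∩ (levelsUpTo d k)ᶜ) 0 φ = ∅ :=
      Set.eq_empty_iff_forall_notMem.2 fun ω h => by simpa using (h [] trivial).1
    simp [this]
  | succ n ih =>
    rw [Function.iterate_succ_apply', truncG]
    by_cases hI : φ ∈ A ∩ (levelsUpTo d k)ᶜ
    · have : truncEventBefore (A ∪ levelsUpTo d l) (A ∩ (levelsUpTo d k)ᶜ) (n + 1) φ = ∅ :=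
        Set.eq_empty_iff_forall_notMem.2 fun ω h => (h [] trivial).2 hI
      rw [if_pos hI, this]
      simp
    by_cases hC : φ ∈ Aᶜ ∩ (levelsUpTo d l)ᶜ
    · have : truncEventBefore (A ∪ levelsUpTo d l) (A ∩ (levelsUpTo d k)ᶜ) (n + 1) φ =
          Set.univ := by
        refine Set.eq_univ_of_forall fun ω w hw => ?_
        obtain rfl | ⟨u, c, rfl⟩ := List.eq_nil_or_concat' w
        · simpa using hI
        · rw [aliveIn_append] at hw
          rw [← Set.compl_union] at hC
          exact absurd hw.1.2.1 hC
      rw [if_neg hI, if_pos hC, this]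
      simp
    · rw [← Set.compl_union, Set.notMem_compl_iff] at hC
      rw [if_neg hI, if_neg (by rwa [← Set.compl_union, Set.notMem_compl_iff]),
        truncEventBefore_succ n hC hI,
        law_forall_children P φ fun j => measurableSet_truncEventBefore _ _ n j]
      congr 1
      exact funext ih

lemma tendsto_truncG_iterate (P : BlockLHBP d) (A : Set (TypeSet d)) (k l : ℕ) :
    Tendsto (fun n : ℕ => (P.truncG A k l)^[n] 0) atTop (𝓝 (P.truncQ A k l)) := by
  refine tendsto_pi_nhds.2 fun φ => ?_
  simp only [truncG_iterate, truncQ_eq, ← iUnion_truncEventBefore]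
  exact (ENNReal.tendsto_toReal (measure_ne_top _ _)).comp
    (tendsto_measure_iUnion_atTop (monotone_truncEventBefore _ _ φ))

/-! ### Lévy's zero-one law along the generations. -/

/-- The filtration generated by the generations. -/
def generationFiltration (d : ℕ) :
    Filtration ℕ (inferInstance : MeasurableSpace (Tree d)) where
  seq n := sigmaOf {u | u.length < n}
  mono' _ _ h := sigmaOf_mono fun _ hu => lt_of_lt_of_le hu h
  le' _ := sigmaOf_le _

lemma iSup_generationFiltration :
    ⨆ n, generationFiltration d n = (inferInstance : MeasurableSpace (Tree d)) := by
  refine le_antisymm (iSup_le fun n => sigmaOf_le _) ?_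
  refine sigmaOf_univ.symm.trans_le ?_
  refine iSup₂_le fun u _ => le_iSup_of_le (u.length + 1) ?_
  exact le_iSup₂ (f := fun v (_ : v ∈ {v : Line d | v.length < u.length + 1}) =>
    MeasurableSpace.comap (fun ω : Tree d => ω v) ⊤) u (Nat.lt_succ_self _)

/-- The offspring of generations before that of `w` decides whether `w` appears and is independent
of the tree of `w`, which has property `H` with its unconditional probability. -/
lemma le_condExp_of_alive (P : BlockLHBP d) (φ : TypeSet d) {Q H : Set (Tree d)}
    (hQ : MeasurableSet Q) (hH : MeasurableSet H) (w : Line d)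
    (hsub : {ω | Alive ω w} ∩ shift w ⁻¹' H ⊆ Q) :
    ∀ᵐ ω ∂P.law φ, Alive ω w → (P.law (lineType φ w)).real H ≤
      ((P.law φ)[Q.indicator (fun _ => (1 : ℝ)) | generationFiltration d w.length]) ω := by
  have hS : MeasurableSet (shift w ⁻¹' H) := measurable_shift w hH
  have halive : MeasurableSet[generationFiltration d w.length] {ω : Tree d | Alive ω w} :=
    measurableSet_sigmaOf_alive fun u hu hne =>
      lt_of_le_of_ne hu.length_le fun h => hne (hu.eq_of_length h)
  have hint : Integrable ((shift w ⁻¹' H).indicator fun _ => (1 : ℝ)) (P.law φ) :=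
    (integrable_const 1).indicator hS
  have h1 : (P.law φ)[{ω | Alive ω w}.indicator ((shift w ⁻¹' H).indicator fun _ => (1 : ℝ)) |
      generationFiltration d w.length] ≤ᵐ[P.law φ]
      (P.law φ)[Q.indicator (fun _ => (1 : ℝ)) | generationFiltration d w.length] := by
    refine condExp_mono (hint.indicator (measurableSet_alive w))
      ((integrable_const 1).indicator hQ) (Eventually.of_forall fun ω => ?_)
    rw [Set.indicator_indicator]
    exact Set.indicator_le_indicator_of_subset hsub (fun _ => zero_le_one) ω
  have h2 := condExp_indicator (m := generationFiltration d w.length) hint halive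
  have hind : ProbabilityTheory.Indep (sigmaOf {u | w <:+ u})
      (generationFiltration d w.length) (P.law φ) :=
    P.indep_sigmaOf φ (Set.disjoint_left.2 fun u hu h => (hu.length_le).not_gt h)
  have h3 := condExp_indep_eq (sigmaOf_le _)
    ((generationFiltration d).le w.length)
    ((stronglyMeasurable_const (b := (1 : ℝ))).indicator (measurable_shift_sigmaOf w hH)) hind
  filter_upwards [h1, h2, h3] with ω h1 h2 h3 hω
  refine le_trans (le_of_eq ?_) h1
  rw [h2, Set.indicator_of_mem (by exact hω), h3, integral_indicator_const _ hS, ← map_shift,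
    map_measureReal_apply (measurable_shift w) hH]
  simp

/-- If a type is visited infinitely often, then infinitely many of these visits give rise to a
tree with a given property of positive probability. -/
lemma ae_recurs_imp_shift_mem (P : BlockLHBP d) (φ j : TypeSet d) {H : Set (Tree d)}
    (hH : MeasurableSet H) (hpos : P.law j H ≠ 0) :
    ∀ᵐ ω ∂P.law φ, Recurs {j} φ ω →
      ∀ n, ∃ w : Line d, n ≤ w.length ∧ Alive ω w ∧ lineType φ w = j ∧ shift w ω ∈ H := by
  have hε : 0 < (P.law j).real H := ENNReal.toReal_pos hpos (measure_ne_top _ _)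
  have key : ∀ n, ∀ᵐ ω ∂P.law φ, Recurs {j} φ ω →
      ∃ w : Line d, n ≤ w.length ∧ Alive ω w ∧ lineType φ w = j ∧ shift w ω ∈ H := by
    intro n
    set Q : Set (Tree d) :=
      {ω | ∃ w : Line d, n ≤ w.length ∧ Alive ω w ∧ lineType φ w = j ∧ shift w ω ∈ H} with hQdef
    have hQ : MeasurableSet Q := by
      simp only [hQdef, Set.ofPred_exists]
      exact .iUnion fun w => (MeasurableSet.const _).inter ((measurableSet_alive w).inter
        ((MeasurableSet.const _).inter (measurable_shift w hH)))
    have hle : ∀ᵐ ω ∂P.law φ, ∀ w : Line d, n ≤ w.length → lineType φ w = j → Alive ω w →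
        (P.law j).real H ≤ ((P.law φ)[Q.indicator (fun _ => (1 : ℝ)) |
          generationFiltration d w.length]) ω := by
      refine ae_all_iff.2 fun w => ?_
      by_cases hn : n ≤ w.length
      · by_cases hj : lineType φ w = j
        · filter_upwards [P.le_condExp_of_alive φ hQ hH w
            fun ω hω => ⟨w, hn, hω.1, hj, hω.2⟩] with ω hω _ _
          rwa [hj] at hω
        · exact Eventually.of_forall fun ω _ h => absurd h hj
      · exact Eventually.of_forall fun ω h => absurd h hn
    have hlim := tendsto_ae_condExp (μ := P.law φ) (ℱ := generationFiltration d)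
      (Q.indicator fun _ => (1 : ℝ))
    rw [iSup_generationFiltration, condExp_of_stronglyMeasurable le_rfl
      (stronglyMeasurable_const.indicator hQ) ((integrable_const 1).indicator hQ)] at hlim
    filter_upwards [hle, hlim] with ω hle hlim hrec
    change ω ∈ Q
    -- Off `Q` the conditional probabilities of `Q` tend to `0`, whereas each late visit to `j`
    -- keeps them above the probability of `H`.
    by_contra hω
    rw [Set.indicator_of_notMem hω] at hlim
    obtain ⟨N, hN⟩ := eventually_atTop.1 (hlim.eventually (gt_mem_nhds hε))
    obtain ⟨w, hw, ha, hj⟩ := hrec (max n N)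
    exact (hN w.length (le_of_max_le_right hw)).not_ge (hle w (le_of_max_le_left hw) hj ha)
  filter_upwards [ae_all_iff.2 key] with ω h hrec n
  exact h n hrec

/-! ### The process of first returns: mean larger than one. -/

/-- The lines along which the type of the root reappears for the first time. -/
def firstReturns (j : TypeSet d) : Set (Line d) :=
  {w | w ≠ [] ∧ lineType j w = j ∧ ∀ v, v <:+ w → v ≠ [] → v ≠ w → lineType j v ≠ j}

lemma not_suffix_of_mem_firstReturns {j : TypeSet d} {v w : Line d} (hv : v ∈ firstReturns j)
    (hw : w ∈ firstReturns j) (hne : v ≠ w) : ¬ v <:+ w :=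
  fun h => hw.2.2 v h hv.1 hne hv.2.1

/-- When neither line is an ancestor of the other, their trees are disjoint, and no strict ancestor
of either line lies in these trees. -/
lemma law_alive_pair_inter_shift (P : BlockLHBP d) (φ : TypeSet d) {v w : Line d}
    (hvw : ¬ v <:+ w) (hwv : ¬ w <:+ v) {H K : Set (Tree d)} (hH : MeasurableSet H)
    (hK : MeasurableSet K) :
    P.law φ (({ω | Alive ω v} ∩ shift v ⁻¹' H) ∩ ({ω | Alive ω w} ∩ shift w ⁻¹' K)) =
      P.law φ ({ω | Alive ω v} ∩ {ω | Alive ω w}) * P.law (lineType φ v) H *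
        P.law (lineType φ w) K := by
  have hS : ∀ {x y : Line d}, ¬ x <:+ y → MeasurableSet[sigmaOf {u | ¬ x <:+ u}]
      {ω : Tree d | Alive ω y} := fun hxy =>
    measurableSet_sigmaOf_alive fun u hu _ hx => hxy (hx.trans hu)
  have hS' : ∀ {x : Line d}, MeasurableSet[sigmaOf {u | ¬ x <:+ u}] {ω : Tree d | Alive ω x} :=
    measurableSet_sigmaOf_alive fun u hu hne hx => hne (hu.eq_of_length_le hx.length_le)
  rw [show ({ω : Tree d | Alive ω v} ∩ shift v ⁻¹' H) ∩ ({ω | Alive ω w} ∩ shift w ⁻¹' K) =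
    (({ω | Alive ω v} ∩ {ω | Alive ω w}) ∩ shift v ⁻¹' H) ∩ shift w ⁻¹' K by
      ext ω; simp only [Set.mem_inter_iff]; tauto,
    P.law_inter_shift φ (S := {u | ¬ w <:+ u}) (fun _ h => h) _ hK,
    P.law_inter_shift φ (S := {u | ¬ v <:+ u}) (fun _ h => h) (hS'.inter (hS hvw)) hH]
  refine ((hS hwv).inter hS').inter ?_
  refine sigmaOf_mono (S := {u | v <:+ u}) ?_ _ (measurable_shift_sigmaOf v hH)
  intro u hvu hwu
  rcases le_total v.length w.length with h | h
  · exact hvw (List.suffix_of_suffix_length_le hvu hwu h)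
  · exact hwv (List.suffix_of_suffix_length_le hwu hvu h)

/-- A Bonferroni inequality; the induction uses `n² + n ≤ (n + 1)²`. -/
lemma sum_measureReal_le_biUnion {Ω ι : Type*} [MeasurableSpace Ω] (μ : Measure Ω)
    [IsFiniteMeasure μ] (B : ι → Set Ω) (hB : ∀ x, MeasurableSet (B x)) (s : Finset ι) {ε : ℝ} (hε : 0 ≤ ε)
    (h : ∀ x ∈ s, ∀ y ∈ s, x ≠ y → μ.real (B x ∩ B y) ≤ ε) :
    ∑ x ∈ s, μ.real (B x) ≤ μ.real (⋃ x ∈ s, B x) + (s.card : ℝ) ^ 2 * ε := by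
  classical
  induction s using Finset.induction_on with
  | empty => simp
  | insert a s ha ih =>
    have ih := ih fun x hx y hy =>
      h x (Finset.mem_insert_of_mem hx) y (Finset.mem_insert_of_mem hy)
    have hU : MeasurableSet (⋃ x ∈ s, B x) := Finset.measurableSet_biUnion s fun x _ => hB x
    have h1 := measureReal_union_add_inter (μ := μ) (s := B a) hU (measure_ne_top _ _) (measure_ne_top _ _)
    have h2 : μ.real (B a ∩ ⋃ x ∈ s, B x) ≤ s.card * ε := by
      rw [Set.inter_iUnion₂]
      refine (measureReal_biUnion_finset_le (μ := μ) s fun x => B a ∩ B x).trans ?_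
      rw [← nsmul_eq_mul]
      refine Finset.sum_le_card_nsmul _ _ _ fun x hx => ?_
      exact h a (Finset.mem_insert_self _ _) x (Finset.mem_insert_of_mem hx)
        fun hax => ha (hax ▸ hx)
    rw [Finset.sum_insert ha, Finset.set_biUnion_insert, Finset.card_insert_of_notMem ha]
    push_cast
    nlinarith [mul_nonneg (Nat.cast_nonneg (α := ℝ) s.card) hε]

/-- There is a line of descent made of `n` segments from `W`. -/
def chainEvent (W : Finset (Line d)) : ℕ → Set (Tree d)
  | 0 => Set.univ
  | n + 1 => ⋃ x ∈ W, {ω | Alive ω x} ∩ shift x ⁻¹' chainEvent W n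

lemma measurableSet_chainEvent (W : Finset (Line d)) (n : ℕ) :
    MeasurableSet (chainEvent W n) := by
  induction n with
  | zero => exact .univ
  | succ n ih =>
    exact Finset.measurableSet_biUnion W fun x _ =>
      (measurableSet_alive x).inter (measurable_shift x ih)

lemma chainEvent_succ_subset (W : Finset (Line d)) (n : ℕ) :
    chainEvent W (n + 1) ⊆ chainEvent W n := by
  induction n with
  | zero => exact Set.subset_univ _
  | succ n ih =>
    exact Set.iUnion₂_mono fun x _ => Set.inter_subset_inter_right _ (Set.preimage_mono ih)

/-- A Galton--Watson process with mean larger than one and bounded offspring survives. -/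
lemma exists_le_law_chainEvent (P : BlockLHBP d) (j : TypeSet d) (W : Finset (Line d))
    (hW : ∀ x ∈ W, x ∈ firstReturns j) (hm : 1 < ∑ x ∈ W, (P.law j).real {ω | Alive ω x}) :
    ∃ δ > 0, ∀ n, δ ≤ (P.law j).real (chainEvent W n) := by
  set m := ∑ x ∈ W, (P.law j).real {ω | Alive ω x} with hmdef
  set b : ℕ → ℝ := fun n => (P.law j).real (chainEvent W n) with hb
  have hb0 : ∀ n, 0 ≤ b n := fun n => measureReal_nonneg
  have hanti : Antitone b := antitone_nat_of_succ_le fun n =>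
    measureReal_mono (chainEvent_succ_subset W n)
  have hcard : 0 < (W.card : ℝ) ^ 2 := by
    have : W.Nonempty := by
      by_contra h
      rw [Finset.not_nonempty_iff_eq_empty] at h
      simp only [hmdef, h, Finset.sum_empty] at hm
      linarith
    have := Finset.card_pos.2 this
    positivity
  have hseg : ∀ x ∈ W, ∀ n, (P.law j).real ({ω | Alive ω x} ∩ shift x ⁻¹' chainEvent W n) =
      (P.law j).real {ω | Alive ω x} * b n := by
    intro x hx n
    rw [Measure.real, law_alive_inter_shift P j x (measurableSet_chainEvent W n),
      (hW x hx).2.1, ENNReal.toReal_mul]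
    rfl
  -- Bonferroni over the first segment: distinct first returns are incomparable, so two of them
  -- continue with joint probability at most `b n ^ 2`.
  have hrec : ∀ n, m * b n ≤ b (n + 1) + (W.card : ℝ) ^ 2 * (b n) ^ 2 := by
    intro n
    rw [hmdef, Finset.sum_mul, ← Finset.sum_congr rfl fun x hx => hseg x hx n]
    refine sum_measureReal_le_biUnion (P.law j)
      (fun x => {ω | Alive ω x} ∩ shift x ⁻¹' chainEvent W n)
      (fun x => (measurableSet_alive x).inter (measurable_shift x (measurableSet_chainEvent W n)))
      W (sq_nonneg _) fun x hx y hy hxy => ?_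
    rw [Measure.real, law_alive_pair_inter_shift P j
      (not_suffix_of_mem_firstReturns (hW x hx) (hW y hy) hxy)
      (not_suffix_of_mem_firstReturns (hW y hy) (hW x hx) hxy.symm)
      (measurableSet_chainEvent W n) (measurableSet_chainEvent W n), (hW x hx).2.1,
      (hW y hy).2.1, mul_assoc, ENNReal.toReal_mul, ENNReal.toReal_mul]
    have h1 : (P.law j).real ({ω | Alive ω x} ∩ {ω | Alive ω y}) ≤ 1 := measureReal_le_one
    change (P.law j).real ({ω | Alive ω x} ∩ {ω | Alive ω y}) * (b n * b n) ≤ b n ^ 2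
    nlinarith [mul_nonneg (hb0 n) (hb0 n)]
  have hpos : ∀ n, 0 < b n := by
    intro n
    induction n with
    | zero => simp [hb, chainEvent]
    | succ n ih =>
      obtain ⟨x, hx, hxpos⟩ : ∃ x ∈ W, 0 < (P.law j).real {ω | Alive ω x} :=
        Finset.exists_lt_of_sum_lt (f := fun _ => (0 : ℝ)) (by simp; linarith)
      have h1 : (P.law j).real ({ω | Alive ω x} ∩ shift x ⁻¹' chainEvent W n) ≤ b (n + 1) :=
        measureReal_mono (Set.subset_biUnion_of_mem (u := fun x =>
          {ω | Alive ω x} ∩ shift x ⁻¹' chainEvent W n) hx)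
      rw [hseg x hx] at h1
      exact (mul_pos hxpos ih).trans_le h1
  -- Since `b (n + 1) ≤ b n`, the recursion gives `(m - 1) * b n ≤ |W|² * (b n)²`; dividing by `b n
  -- > 0` gives the bound.
  refine ⟨(m - 1) / (W.card : ℝ) ^ 2, div_pos (by linarith) hcard, fun n => ?_⟩
  rw [div_le_iff₀ hcard]
  have h1 := hrec n
  have h2 := hanti n.le_succ
  have h3 : (m - 1) * b n ≤ (b n * (W.card : ℝ) ^ 2) * b n := by nlinarith
  exact le_of_mul_le_mul_right h3 (hpos n)

lemma exists_aliveIn_of_mem_chainEvent {j : TypeSet d} {W : Finset (Line d)} {l : ℕ}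
    (hW : ∀ x ∈ W, x ∈ firstReturns j)
    (hl : ∀ x ∈ W, ∀ ω : Tree d, Alive ω x → AliveIn (levelsUpTo d l) j ω x) (n : ℕ)
    (ω : Tree d) (hω : ω ∈ chainEvent W n) :
    ∃ w : Line d, n ≤ w.length ∧ AliveIn (levelsUpTo d l) j ω w := by
  induction n generalizing ω with
  | zero => exact ⟨[], le_rfl, trivial⟩
  | succ n ih =>
    simp only [chainEvent, Set.mem_iUnion] at hω
    obtain ⟨x, hx, hax, hsx⟩ := hω
    obtain ⟨u, hu, hau⟩ := ih _ hsx
    refine ⟨u ++ x, ?_, (aliveIn_append _ _ _ _ _).2 ⟨hl x hx ω hax, ?_⟩⟩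
    · have := List.length_pos_iff.2 (hW x hx).1
      simp only [List.length_append]
      omega
    · rwa [(hW x hx).2.1]

/-- A finite partial sum already exceeds one, and finitely many lines stay within finitely many
levels. The chain events decrease and have probability bounded below, so their intersection is not
null. -/
lemma exists_survivesIn_of_one_lt (P : BlockLHBP d) (j : TypeSet d)
    (hm : 1 < ∑' x : firstReturns j, P.law j {ω | Alive ω x.1}) :
    ∃ l, P.law j {ω | SurvivesIn (levelsUpTo d l) j ω} ≠ 0 := by
  classical
  rw [ENNReal.tsum_eq_iSup_sum, lt_iSup_iff] at hm
  obtain ⟨V, hV⟩ := hm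
  set W : Finset (Line d) := V.map (Function.Embedding.subtype _) with hWdef
  have hW : ∀ x ∈ W, x ∈ firstReturns j := by
    intro x hx
    obtain ⟨y, -, rfl⟩ := Finset.mem_map.1 hx
    exact y.2
  have hsum : 1 < ∑ x ∈ W, (P.law j).real {ω | Alive ω x} := by
    rw [hWdef, Finset.sum_map]
    simp only [Measure.real]
    rw [← ENNReal.toReal_sum fun _ _ => measure_ne_top _ _, ← ENNReal.toReal_one]
    exact (ENNReal.toReal_lt_toReal ENNReal.one_ne_top
      (ENNReal.sum_ne_top.2 fun _ _ => measure_ne_top _ _)).2 hV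
  obtain ⟨δ, hδ, hle⟩ := P.exists_le_law_chainEvent j W hW hsum
  choose l hl using exists_aliveIn_levelsUpTo (d := d) j
  refine ⟨W.sup l, fun h0 => ?_⟩
  have hlim := tendsto_measure_iInter_atTop (μ := P.law j)
    (fun n => (measurableSet_chainEvent W n).nullMeasurableSet)
    (antitone_nat_of_succ_le (chainEvent_succ_subset W)) ⟨0, measure_ne_top _ _⟩
  have hsub : ⋂ n, chainEvent W n ⊆ {ω | SurvivesIn (levelsUpTo d (W.sup l)) j ω} := by
    intro ω hω n
    exact exists_aliveIn_of_mem_chainEvent hW (fun x hx ω h =>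
      (hl x ω h).mono (levelsUpTo_mono (Finset.le_sup hx))) n ω (Set.mem_iInter.1 hω n)
  rw [measure_mono_null hsub h0] at hlim
  have hlim' : Tendsto (fun n => (P.law j).real (chainEvent W n)) atTop (𝓝 0) :=
    (ENNReal.tendsto_toReal ENNReal.zero_ne_top).comp hlim
  exact absurd (ge_of_tendsto' hlim' hle) (not_le.2 hδ)

/-! ### The process of first returns: mean at most one. -/

lemma exists_firstReturn_suffix {j : TypeSet d} {w : Line d} (hw : w ≠ []) (hj : lineType j w = j) :
    ∃ x ∈ firstReturns j, x <:+ w := by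
  induction hn : w.length using Nat.strong_induction_on generalizing w with
  | _ n ih =>
    by_cases h : w ∈ firstReturns j
    · exact ⟨w, h, List.suffix_rfl⟩
    · simp only [firstReturns, Set.mem_ofPred_eq, not_and, not_forall, not_not] at h
      obtain ⟨v, hvw, hv, hne, hvj⟩ := h hw hj
      have hlt : v.length < n := hn ▸ lt_of_le_of_ne hvw.length_le
        fun h => hne (hvw.eq_of_length h)
      obtain ⟨x, hx, hxv⟩ := ih _ hlt hv hvj rfl
      exact ⟨x, hx, hxv.trans hvw⟩

/-- Each later visit to `j` passes through a first return. If none of the finitely many first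
returns had a recurrent tree, all visits would stop by a common generation. -/
lemma recurs_shift_of_finite {j : TypeSet d} {ω : Tree d} (hrec : Recurs {j} j ω)
    (hfin : {x : firstReturns j | Alive ω x.1}.Finite) :
    ∃ x : firstReturns j, Alive ω x.1 ∧ Recurs {j} j (shift x.1 ω) := by
  by_contra! h
  have h' : ∀ x : firstReturns j, Alive ω x.1 → ∃ n, ∀ w : Line d, n ≤ w.length →
      Alive (shift x.1 ω) w → lineType j w ≠ j := by
    intro x hx
    simpa [Recurs] using h x hx
  choose! N hN using h'
  obtain ⟨M, hM⟩ := (hfin.image fun x => N x + x.1.length).bddAbove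
  obtain ⟨w, hw, ha, hj⟩ := hrec (M + 1)
  obtain ⟨x, hx, u, rfl⟩ := exists_firstReturn_suffix (w := w) (by rintro rfl; simp at hw) hj
  rw [alive_append] at ha
  have hle : N ⟨x, hx⟩ + x.length ≤ M := hM ⟨⟨x, hx⟩, ha.1, rfl⟩
  rw [List.length_append] at hw
  refine hN ⟨x, hx⟩ ha.1 u (by omega) ha.2 ?_
  have : lineType j (u ++ x) = j := hj
  rwa [lineType_append, hx.2.1] at this

/-- Equality in the union bound: replacing `B x` by `B x \ B y` keeps the union and lowers the
finite sum by the measure of the overlap. -/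
lemma pairwise_inter_null_of_tsum_le {Ω ι : Type*} [Countable ι] [MeasurableSpace Ω]
    (μ : Measure Ω) [IsFiniteMeasure μ] {B : ι → Set Ω} (hB : ∀ x, MeasurableSet (B x))
    (h : ∑' x, μ (B x) ≤ μ (⋃ x, B x)) {x y : ι} (hxy : x ≠ y) : μ (B x ∩ B y) = 0 := by
  classical
  have hsub : ⋃ z, B z ⊆ ⋃ z, (Function.update B x (B x \ B y)) z := by
    intro ω hω
    obtain ⟨z, hz⟩ := Set.mem_iUnion.1 hω
    by_cases hy : ω ∈ B y
    · exact Set.mem_iUnion.2 ⟨y, by rwa [Function.update_of_ne hxy.symm]⟩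
    · rcases eq_or_ne z x with rfl | hzx
      · exact Set.mem_iUnion.2 ⟨z, by rw [Function.update_self]; exact ⟨hz, hy⟩⟩
      · exact Set.mem_iUnion.2 ⟨z, by rwa [Function.update_of_ne hzx]⟩
  have h1 := h.trans ((measure_mono hsub).trans (measure_iUnion_le _))
  rw [ENNReal.tsum_eq_add_tsum_ite x, ENNReal.tsum_eq_add_tsum_ite (f := fun z =>
    μ (Function.update B x (B x \ B y) z)) x, Function.update_self,
    ← measure_inter_add_sdiff (B x) (hB y)] at h1
  have h2 : (∑' z, if z = x then 0 else μ (Function.update B x (B x \ B y) z)) =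
      ∑' z, if z = x then 0 else μ (B z) := by
    refine tsum_congr fun z => ?_
    split_ifs with hz
    · rfl
    · rw [Function.update_of_ne hz]
  have hfin : (∑' z, if z = x then 0 else μ (B z)) ≠ ⊤ := by
    refine ne_top_of_le_ne_top (ne_top_of_le_ne_top (measure_ne_top μ _) h) ?_
    refine ENNReal.tsum_le_tsum fun z => ?_
    split_ifs
    · exact zero_le
    · exact le_rfl
  rw [h2] at h1
  have h3 := ENNReal.le_of_add_le_add_right hfin h1
  have h4 : μ (B x ∩ B y) + μ (B x \ B y) ≤ 0 + μ (B x \ B y) := by simpa using h3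
  exact le_antisymm (ENNReal.le_of_add_le_add_right (measure_ne_top _ _) h4) (zero_le)

/-- If a type is recurrent with positive probability and its mean number of first returns is at
most one, then there is almost surely exactly one first return. -/
lemma unique_firstReturn_of_recurs (P : BlockLHBP d) (j : TypeSet d)
    (hrec : P.law j {ω | Recurs {j} j ω} ≠ 0)
    (hm : ∑' x : firstReturns j, P.law j {ω | Alive ω x.1} ≤ 1) :
    (∀ x ∈ firstReturns j, ∀ y ∈ firstReturns j, x ≠ y →
      P.law j ({ω | Alive ω x} ∩ {ω | Alive ω y}) = 0) ∧
    ∀ᵐ ω ∂P.law j, ∃ x ∈ firstReturns j, Alive ω x := by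
  set R : Set (Tree d) := {ω | Recurs {j} j ω} with hR
  have hRm : MeasurableSet R := measurableSet_recurs {j} j
  set B : firstReturns j → Set (Tree d) := fun x => {ω | Alive ω x.1} ∩ shift x.1 ⁻¹' R with hBdef
  have hB : ∀ x, MeasurableSet (B x) := fun x =>
    (measurableSet_alive x.1).inter (measurable_shift x.1 hRm)
  have hμB : ∀ x, P.law j (B x) = P.law j {ω | Alive ω x.1} * P.law j R := fun x => by
    rw [hBdef, law_alive_inter_shift P j x.1 hRm, x.2.2.1]
  -- Borel-Cantelli, as the mean number of first returns is finite.
  have hfin : ∀ᵐ ω ∂P.law j, {x : firstReturns j | Alive ω x.1}.Finite :=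
    ae_finite_setOfPred_mem (s := fun x : firstReturns j => {ω | Alive ω x.1})
      (ne_top_of_le_ne_top ENNReal.one_ne_top hm)
  have hle : P.law j R ≤ P.law j (⋃ x, B x) := by
    refine measure_mono_ae ?_
    filter_upwards [hfin] with ω hω hr
    obtain ⟨x, hx, hx'⟩ := recurs_shift_of_finite hr hω
    exact Set.mem_iUnion.2 ⟨x, hx, hx'⟩
  have hsum : ∑' x, P.law j (B x) =
      (∑' x : firstReturns j, P.law j {ω | Alive ω x.1}) * P.law j R := by
    rw [← ENNReal.tsum_mul_right]
    exact tsum_congr hμB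
  have hpair : ∀ x ∈ firstReturns j, ∀ y ∈ firstReturns j, x ≠ y →
      P.law j ({ω | Alive ω x} ∩ {ω | Alive ω y}) = 0 := by
    intro x hx y hy hxy
    -- With mean at most one, the sum of the `B x` is at most `P(R)`, hence at most the measure of
    -- their union. The null overlap factors as the probability that both `x` and `y` appear, times
    -- `P(R)²`, and `P(R)` is positive.
    have h0 := pairwise_inter_null_of_tsum_le (P.law j) hB (x := ⟨x, hx⟩) (y := ⟨y, hy⟩) (by
      rw [hsum]
      exact (mul_le_mul_left hm _).trans ((one_mul _).le.trans hle)) (by simpa using hxy)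
    rw [hBdef, law_alive_pair_inter_shift P j
      (not_suffix_of_mem_firstReturns hx hy hxy) (not_suffix_of_mem_firstReturns hy hx hxy.symm)
      hRm hRm, hx.2.1, hy.2.1] at h0
    simpa [hrec] using h0
  refine ⟨hpair, ?_⟩
  have h1 : 1 ≤ ∑' x : firstReturns j, P.law j {ω | Alive ω x.1} := by
    have h2 := hle.trans (measure_iUnion_le B)
    rw [hsum] at h2
    refine (ENNReal.mul_le_mul_iff_left hrec (measure_ne_top _ _)).1 ?_
    rwa [one_mul]
  set A : firstReturns j → Set (Tree d) := fun x => {ω | Alive ω x.1} with hA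
  have hAm : ∀ x, MeasurableSet (A x) := fun x => measurableSet_alive x.1
  have hdis : Pairwise (Function.onFun (AEDisjoint (P.law j)) A) := fun x y hxy =>
    hpair x.1 x.2 y.1 y.2 fun h => hxy (Subtype.ext h)
  have h2 : P.law j (⋃ x, A x) = 1 := by
    rw [measure_iUnion₀ hdis fun x => (hAm x).nullMeasurableSet]
    exact le_antisymm hm h1
  have h3 : ∀ᵐ ω ∂P.law j, ω ∈ ⋃ x, A x :=
    (prob_compl_eq_zero_iff (MeasurableSet.iUnion hAm)).2 h2
  filter_upwards [h3] with ω hω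
  obtain ⟨x, hx⟩ := Set.mem_iUnion.1 hω
  exact ⟨x.1, x.2, hx⟩

/-! ### From a unique first return to singularity. -/

lemma law_alive_append (P : BlockLHBP d) (φ : TypeSet d) (u w : Line d) :
    P.law φ {ω | Alive ω (u ++ w)} =
      P.law φ {ω | Alive ω w} * P.law (lineType φ w) {ω | Alive ω u} := by
  rw [← law_alive_inter_shift P φ w (measurableSet_alive u)]
  congr 1
  ext ω
  exact alive_append ω u w

lemma exists_alive_of_M_pos (P : BlockLHBP d) {a b : TypeSet d} (h : 0 < P.M a b) :
    P.law a {ω | Alive ω [(0, b)]} ≠ 0 := by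
  rw [M, pos_iff_ne_zero, ne_eq, ENNReal.tsum_eq_zero, not_forall] at h
  obtain ⟨r, hr⟩ := h
  have h1 : P.law a {ω | ω [] = r} ≠ 0 := by
    rw [law_root_eq]
    exact left_ne_zero_of_mul hr
  have h2 : r b ≠ 0 := by
    rintro h
    simp [h] at hr
  refine fun h0 => h1 (measure_mono_null (fun ω hω => ?_) h0)
  have hω' : ω [] = r := hω
  exact ⟨trivial, by rw [hω']; exact Nat.pos_of_ne_zero h2⟩

/-- In an irreducible process, each type has descendants of each type. -/
lemma Irreducible.exists_line {P : BlockLHBP d} (hirr : P.Irreducible) (a b : TypeSet d) :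
    ∃ w : Line d, lineType a w = b ∧ P.law a {ω | Alive ω w} ≠ 0 := by
  induction hirr a b with
  | refl => exact ⟨[], rfl, by simp⟩
  | tail _ hbc ih =>
    obtain ⟨w, rfl, hpos⟩ := ih
    refine ⟨[(0, _)] ++ w, rfl, ?_⟩
    rw [law_alive_append]
    exact mul_ne_zero hpos (exists_alive_of_M_pos P hbc)

lemma Irreducible.exists_shortest_line {P : BlockLHBP d} (hirr : P.Irreducible)
    (a b : TypeSet d) :
    ∃ w : Line d, lineType a w = b ∧ P.law a {ω | Alive ω w} ≠ 0 ∧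
      ∀ v : Line d, lineType a v = b → P.law a {ω | Alive ω v} ≠ 0 → w.length ≤ v.length := by
  obtain ⟨w, ⟨hw, hpos⟩, hmin⟩ := (measure (List.length (α := ℕ × TypeSet d))).wf.has_min
    {w | lineType a w = b ∧ P.law a {ω | Alive ω w} ≠ 0} (hirr.exists_line a b)
  exact ⟨w, hw, hpos, fun v hv hv' => not_lt.1 (hmin v ⟨hv, hv'⟩)⟩

/-- There is a line to a given type along which the type of the root does not reappear. -/
lemma Irreducible.exists_line_avoiding {P : BlockLHBP d} (hirr : P.Irreducible)
    (j i : TypeSet d) :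
    ∃ w : Line d, lineType j w = i ∧ P.law j {ω | Alive ω w} ≠ 0 ∧
      ∀ v, v <:+ w → v ≠ [] → lineType j v ≠ j := by
  obtain ⟨w, hw, hpos, hmin⟩ := hirr.exists_shortest_line j i
  refine ⟨w, hw, hpos, ?_⟩
  rintro v ⟨u, rfl⟩ hv hvj
  rw [law_alive_append, hvj] at hpos
  -- If `j` reappeared at `v`, the part `u` after `v` would be a shorter line from `j` to `i`.
  have h1 := hmin u (by rwa [lineType_append, hvj] at hw) (right_ne_zero_of_mul hpos)
  have h2 := List.length_pos_iff.2 hv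
  rw [List.length_append] at h1
  omega

/-- There is a line that ends with the first occurrence of a given type. -/
lemma Irreducible.exists_line_hitting {P : BlockLHBP d} (hirr : P.Irreducible)
    (i j : TypeSet d) :
    ∃ u : Line d, lineType i u = j ∧ P.law i {ω | Alive ω u} ≠ 0 ∧
      ∀ v, v <:+ u → v ≠ u → lineType i v ≠ j := by
  obtain ⟨u, hu, hpos, hmin⟩ := hirr.exists_shortest_line i j
  refine ⟨u, hu, hpos, fun v hv hne hvj => hne (hv.eq_of_length_le (hmin v hvj ?_))⟩
  obtain ⟨t, rfl⟩ := hv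
  rw [law_alive_append] at hpos
  exact left_ne_zero_of_mul hpos

lemma append_mem_firstReturns {j : TypeSet d} {u w : Line d} (hw : w ≠ [])
    (hwj : ∀ v, v <:+ w → v ≠ [] → v ≠ w → lineType j v ≠ j)
    (hu : lineType (lineType j w) u = j)
    (huj : ∀ v, v <:+ u → v ≠ u → lineType (lineType j w) v ≠ j) :
    u ++ w ∈ firstReturns j := by
  refine ⟨by simp [hw], by rw [lineType_append, hu], fun v hv hne hne' => ?_⟩
  by_cases hvw : v <:+ w ∧ v ≠ w
  · exact hwj v hvw.1 hne hvw.2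
  · obtain ⟨t, rfl⟩ : w <:+ v := by
      rcases le_total v.length w.length with h | h
      · have h1 := List.suffix_of_suffix_length_le hv (List.suffix_append u w) h
        have h2 : v = w := by
          by_contra h2
          exact hvw ⟨h1, h2⟩
        exact h2 ▸ List.suffix_rfl
      · exact List.suffix_of_suffix_length_le (List.suffix_append u w) hv h
    rw [lineType_append]
    refine huj t ?_ fun h => hne' (by rw [h])
    obtain ⟨s, hs⟩ := hv
    exact ⟨s, List.append_cancel_right (bs := w) (by rw [← hs, List.append_assoc])⟩

lemma law_alive_inter_offspring (P : BlockLHBP d) (φ : TypeSet d) (w : Line d)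
    (r : OffspringVector d) :
    P.law φ ({ω | Alive ω w} ∩ {ω | ω w = r}) =
      P.law φ {ω | Alive ω w} * P.p (lineType φ w) r := by
  rw [← law_root_eq]
  exact law_alive_inter_shift P φ w (measurableSet_eval [] {r})

/-- In an irreducible process, if a type has almost surely exactly one first return, then each
individual has exactly one child. -/
lemma singular_of_unique_firstReturn {P : BlockLHBP d} (hirr : P.Irreducible) (j : TypeSet d)
    (hpair : ∀ x ∈ firstReturns j, ∀ y ∈ firstReturns j, x ≠ y →
      P.law j ({ω | Alive ω x} ∩ {ω | Alive ω y}) = 0)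
    (hex : ∀ᵐ ω ∂P.law j, ∃ x ∈ firstReturns j, Alive ω x) : P.Singular := by
  intro i r hr
  rw [PMF.mem_support_iff] at hr
  obtain ⟨w, rfl, hw, hwj⟩ := hirr.exists_line_avoiding j i
  choose u hu hupos huj using fun i => hirr.exists_line_hitting i j
  have hwr : P.law j ({ω | Alive ω w} ∩ {ω | ω w = r}) ≠ 0 := by
    rw [law_alive_inter_offspring]
    exact mul_ne_zero hw hr
  rw [← card_children]
  refine le_antisymm ?_ ?_
  -- Two children of `w`, each continued to its first hit of `j`, give two distinct first returns
  -- that appear together with positive probability.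
  · by_contra hcard
    obtain ⟨a, ha, b, hb, hab⟩ := Finset.one_lt_card.1 (not_le.1 hcard)
    have hmem : ∀ c : ℕ × TypeSet d, u c.2 ++ c :: w ∈ firstReturns j := by
      intro c
      refine append_mem_firstReturns (by simp) (fun v hv hne hne' => ?_) (hu c.2) (huj c.2)
      exact hwj v ((List.suffix_cons_iff.1 hv).resolve_left hne') hne
    have hincomp : ∀ {a b : ℕ × TypeSet d}, a ≠ b → ∀ {v : Line d},
        v <:+ w ∨ a :: w <:+ v → ¬ b :: w <:+ v := by
      rintro a b hab v (hv | hv) hv'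
      · have := (hv'.trans hv).length_le
        simp at this
      · have := (List.suffix_of_suffix_length_le hv hv' (by simp)).eq_of_length (by simp)
        exact hab (List.cons.inj this).1
    have hne : u a.2 ++ a :: w ≠ u b.2 ++ b :: w := by
      intro h
      exact hincomp hab (Or.inr (List.suffix_append _ _)) (h ▸ List.suffix_append (u b.2) (b :: w))
    have hm0 : ∀ {S : Set (Line d)}, (∀ v, v <:+ w → v ∈ S) →
        MeasurableSet[sigmaOf S] ({ω : Tree d | Alive ω w} ∩ {ω | ω w = r}) := fun hS =>
      (measurableSet_sigmaOf_alive fun v hv _ => hS v hv).inter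
        (measurableSet_sigmaOf_eval (hS w List.suffix_rfl) {r})
    have h1 : P.law j (({ω | Alive ω w} ∩ {ω | ω w = r}) ∩
        shift (a :: w) ⁻¹' {ω | Alive ω (u a.2)} ∩ shift (b :: w) ⁻¹' {ω | Alive ω (u b.2)}) ≠ 0 := by
      rw [P.law_inter_shift j (S := {v | ¬ b :: w <:+ v}) (fun _ h => h) _ (measurableSet_alive _),
        P.law_inter_shift j (S := {v | v <:+ w}) _ (hm0 fun _ h => h) (measurableSet_alive _)]
      · exact mul_ne_zero (mul_ne_zero hwr (hupos a.2)) (hupos b.2)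
      · exact fun v hv => hincomp hab.symm (Or.inl hv)
      · refine (hm0 fun v hv => hincomp hab (Or.inl hv)).inter ?_
        exact sigmaOf_mono (S := {v | a :: w <:+ v}) (fun v hv => hincomp hab (Or.inr hv)) _
          (measurable_shift_sigmaOf (a :: w) (measurableSet_alive _))
    refine h1 (measure_mono_null ?_ (hpair _ (hmem a) _ (hmem b) hne))
    rintro ω ⟨⟨⟨h1, h2⟩, h3⟩, h4⟩
    have h2' : ω w = r := h2
    exact ⟨(alive_append _ _ _).2 ⟨⟨h1, h2' ▸ mem_children.1 ha⟩, h3⟩,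
      (alive_append _ _ _).2 ⟨⟨h1, h2' ▸ mem_children.1 hb⟩, h4⟩⟩
  -- Without children of `w`, no first return appears: one below `w` would need a child of `w`, and
  -- any other is excluded by uniqueness.
  · by_contra hcard
    have hr0 : children r = ∅ := Finset.card_eq_zero.1 (by omega)
    refine hwr ?_
    have h0 : ∀ x ∈ firstReturns j,
        P.law j ({ω | Alive ω w} ∩ {ω | ω w = r} ∩ {ω | Alive ω x}) = 0 := by
      intro x hx
      by_cases hwx : w <:+ x
      · obtain ⟨t, rfl⟩ := hwx
        obtain rfl | ⟨t, c, rfl⟩ := List.eq_nil_or_concat' t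
        · exact absurd hx.2.1 (hwj _ List.suffix_rfl hx.1)
        · refine measure_mono_null ?_ measure_empty
          rintro ω ⟨⟨-, h2⟩, h3⟩
          have h2' : ω w = r := h2
          have h3' : Alive ω (t ++ ([c] ++ w)) := by
            rw [← List.append_assoc]
            exact h3
          rw [alive_append] at h3'
          have h4 : c ∈ children r := mem_children.2 (h2' ▸ h3'.1.2)
          simp [hr0] at h4
      -- Here `x` and `w` are incomparable. Were they to appear together with positive probability,
      -- `w` could be continued independently to another first return.
      · have hxw : ¬ x <:+ w := fun h => hwj x h hx.1 hx.2.1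
        have hw0 : w ≠ [] := by
          rintro rfl
          exact hwx List.nil_suffix
        have hy : u (lineType j w) ++ w ∈ firstReturns j :=
          append_mem_firstReturns hw0 (fun v hv hne _ => hwj v hv hne) (hu _) (huj _)
        have h1 := hpair x hx _ hy (by rintro rfl; exact hwx (List.suffix_append _ _))
        have h2 := law_alive_pair_inter_shift P j hxw hwx MeasurableSet.univ
          (measurableSet_alive (u (lineType j w)))
        have h3 : P.law j ({ω | Alive ω x} ∩ {ω | Alive ω w}) = 0 := by
          have h4 : {ω : Tree d | Alive ω (u (lineType j w) ++ w)} =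
              {ω | Alive ω w} ∩ shift w ⁻¹' {ω | Alive ω (u (lineType j w))} := by
            ext ω
            exact alive_append _ _ _
          rw [Set.preimage_univ, Set.inter_univ, ← h4, h1, measure_univ, mul_one] at h2
          exact (mul_eq_zero.1 h2.symm).resolve_right (hupos _)
        exact measure_mono_null (fun ω hω => Set.mem_inter hω.2 hω.1.1) h3
    have h1 : P.law j (⋃ x ∈ firstReturns j,
        {ω | Alive ω w} ∩ {ω | ω w = r} ∩ {ω | Alive ω x}) = 0 :=
      (measure_biUnion_null_iff (Set.to_countable _)).2 h0
    refine measure_mono_null_ae ?_ h1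
    filter_upwards [hex] with ω hω hωr
    obtain ⟨x, hx, ha⟩ := hω
    exact Set.mem_biUnion hx ⟨hωr, ha⟩

/-! ### Recurrence, local survival and the almost sure identity. -/

lemma Recurs.mono {B C : Set (TypeSet d)} (h : B ⊆ C) {φ : TypeSet d} {ω : Tree d}
    (hr : Recurs B φ ω) : Recurs C φ ω := fun n =>
  (hr n).imp fun _ hw => ⟨hw.1, hw.2.1, h hw.2.2⟩

lemma Recurs.of_shift {B : Set (TypeSet d)} {φ : TypeSet d} {ω : Tree d} {w : Line d}
    (hw : Alive ω w) (hr : Recurs B (lineType φ w) (shift w ω)) : Recurs B φ ω := by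
  intro n
  obtain ⟨u, hn, ha, hu⟩ := hr n
  exact ⟨u ++ w, by simp; omega, (alive_append _ _ _).2 ⟨hw, ha⟩, by rwa [lineType_append]⟩

lemma Recurs.exists_singleton {F : Set (TypeSet d)} (hF : F.Finite) {φ : TypeSet d} {ω : Tree d}
    (hr : Recurs F φ ω) : ∃ j ∈ F, Recurs {j} φ ω := by
  by_contra! h
  have h' : ∀ j ∈ F, ∃ n, ∀ w : Line d, n ≤ w.length → Alive ω w → lineType φ w ≠ j := by
    intro j hj
    simpa [Recurs] using h j hj
  choose! N hN using h'
  obtain ⟨M, hM⟩ := (hF.image N).bddAbove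
  obtain ⟨w, hw, ha, hj⟩ := hr M
  exact hN _ hj w ((hM ⟨_, hj, rfl⟩).trans hw) ha rfl

lemma Recurs.or_of_union {B C : Set (TypeSet d)} {φ : TypeSet d} {ω : Tree d}
    (hr : Recurs (B ∪ C) φ ω) : Recurs B φ ω ∨ Recurs C φ ω := by
  by_contra! h
  simp only [Recurs, not_forall, not_exists, not_and] at h
  obtain ⟨⟨m, hm⟩, n, hn⟩ := h
  obtain ⟨w, hw, ha, hB | hC⟩ := hr (max m n)
  · exact hm w (le_of_max_le_left hw) ha hB
  · exact hn w (le_of_max_le_right hw) ha hC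

/-- The last individual of a line may be sterile, but its parent is fertile; hence the passage to
generation `n + 1`. -/
lemma SurvivesIn.recurs {C : Set (TypeSet d)} {φ : TypeSet d} {ω : Tree d}
    (h : SurvivesIn C φ ω) : Recurs C φ ω := by
  intro n
  obtain ⟨w, hw, ha⟩ := h (n + 1)
  cases w with
  | nil => simp at hw
  | cons c w => exact ⟨w, by simpa using hw, ha.1.alive, ha.2.1⟩

lemma SurvivesIn.mono {C D : Set (TypeSet d)} (hCD : C ⊆ D) {φ : TypeSet d} {ω : Tree d}
    (h : SurvivesIn C φ ω) : SurvivesIn D φ ω := fun n =>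
  (h n).imp fun _ hw => ⟨hw.1, hw.2.mono hCD⟩

/-- Recurrence is almost surely a class property. -/
lemma Irreducible.ae_recurs_of_recurs {P : BlockLHBP d} (hirr : P.Irreducible)
    (φ j a : TypeSet d) : ∀ᵐ ω ∂P.law φ, Recurs {j} φ ω → Recurs {a} φ ω := by
  obtain ⟨u, hu, hpos⟩ := hirr.exists_line j a
  filter_upwards [P.ae_recurs_imp_shift_mem φ j (measurableSet_alive u) hpos] with ω h hr n
  obtain ⟨w, hn, ha, hj, hw⟩ := h hr n
  refine ⟨u ++ w, by simp; omega, (alive_append _ _ _).2 ⟨ha, hw⟩, ?_⟩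
  rw [lineType_append, hj, hu]
  rfl

/-- In a non-singular irreducible process, a recurrent type survives locally. -/
lemma Irreducible.ae_survivesIn_of_recurs {P : BlockLHBP d} (hirr : P.Irreducible)
    (hns : ¬ P.Singular) (φ j : TypeSet d) :
    ∀ᵐ ω ∂P.law φ, Recurs {j} φ ω → ∃ l, SurvivesIn (levelsUpTo d l) φ ω := by
  by_cases h0 : P.law φ {ω | Recurs {j} φ ω} = 0
  · filter_upwards [measure_eq_zero_iff_ae_notMem.1 h0] with ω hω hr
    exact absurd hr hω
  obtain ⟨z, hz, hzpos⟩ := hirr.exists_line j φ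
  -- A root of type `j` has a descendant of type `φ` with positive probability, and its tree may in
  -- turn visit `j` recurrently.
  have hj : P.law j {ω | Recurs {j} j ω} ≠ 0 := by
    intro h
    have h1 := law_alive_inter_shift P j z (measurableSet_recurs {j} φ)
    rw [hz, measure_mono_null _ h] at h1
    · exact mul_ne_zero hzpos h0 h1.symm
    · rintro ω ⟨h2, h3⟩
      exact Recurs.of_shift h2 (by rw [hz]; exact h3)
  have hm : 1 < ∑' x : firstReturns j, P.law j {ω | Alive ω x.1} := by
    by_contra hm
    obtain ⟨h1, h2⟩ := P.unique_firstReturn_of_recurs j hj (not_lt.1 hm)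
    exact hns (singular_of_unique_firstReturn hirr j h1 h2)
  obtain ⟨l, hl⟩ := P.exists_survivesIn_of_one_lt j hm
  filter_upwards [P.ae_recurs_imp_shift_mem φ j (measurableSet_survivesIn _ j) hl] with ω h hr
  obtain ⟨w, -, ha, hwj, hw⟩ := h hr 0
  obtain ⟨l', hl'⟩ := exists_aliveIn_levelsUpTo φ w
  -- The levels up to `l'` cover the line to `w`, those up to `l` the survival below `w`.
  refine ⟨max l l', fun n => ?_⟩
  obtain ⟨u, hn, hu⟩ := hw n
  refine ⟨u ++ w, by simp; omega, (aliveIn_append _ _ _ _ _).2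
    ⟨(hl' ω ha).mono (levelsUpTo_mono (le_max_right _ _)), ?_⟩⟩
  rw [hwj]
  exact hu.mono (levelsUpTo_mono (le_max_left _ _))

/-- This holds surely, because offspring vectors have finite support. -/
lemma finite_alive (ω : Tree d) (n : ℕ) : {w : Line d | w.length < n ∧ Alive ω w}.Finite := by
  induction n with
  | zero => simp
  | succ n ih =>
    refine ((Set.finite_singleton ([] : Line d)).union (ih.biUnion fun w _ =>
      (children (ω w)).finite_toSet.image fun c => c :: w)).subset ?_
    rintro w ⟨hw, ha⟩
    cases w with
    | nil => exact Or.inl rfl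
    | cons c w =>
      exact Or.inr (Set.mem_biUnion (x := w) ⟨by simpa using hw, ha.1⟩
        ⟨c, mem_children.2 ha.2, rfl⟩)

/-- Up to null sets, extinction in `A` means that `A` is avoided above some level, and that the
process becomes extinct when types outside `A` above any given level are made sterile. -/
lemma ae_not_recurs_iff {P : BlockLHBP d} (hirr : P.Irreducible) {A : Set (TypeSet d)}
    (hA : A.Nonempty) (hrec : A.Infinite ∨ ¬ P.Singular ∨ P.qPartial = 1) (φ : TypeSet d) :
    ∀ᵐ ω ∂P.law φ, ¬ Recurs A φ ω ↔
      ∃ k, ∀ l, ω ∈ truncEvent (A ∪ levelsUpTo d l) (A ∩ (levelsUpTo d k)ᶜ) φ := by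
  have hclass : ∀ᵐ ω ∂P.law φ, ∀ j a, Recurs {j} φ ω → Recurs {a} φ ω :=
    ae_all_iff.2 fun j => ae_all_iff.2 fun a => hirr.ae_recurs_of_recurs φ j a
  -- The only use of the trichotomy: an infinite `A` has types above level `k`, which recur with
  -- `j`; non-singularity gives local survival; almost sure partial extinction excludes recurrence
  -- of `j`.
  have hback : ∀ᵐ ω ∂P.law φ, ∀ k j, Recurs {j} φ ω → j ∈ levelsUpTo d k →
      (∃ a ∈ A ∩ (levelsUpTo d k)ᶜ, Recurs {a} φ ω) ∨
        ∃ l, SurvivesIn (levelsUpTo d l) φ ω := by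
    rcases hrec with hinf | hns | hq
    · filter_upwards [hclass] with ω h k j hr _
      obtain ⟨a, ha, hak⟩ := hinf.exists_notMem_finite (finite_levelsUpTo k)
      exact Or.inl ⟨a, ⟨ha, hak⟩, h j a hr⟩
    · have : ∀ᵐ ω ∂P.law φ, ∀ j, Recurs {j} φ ω → ∃ l, SurvivesIn (levelsUpTo d l) φ ω :=
        ae_all_iff.2 fun j => hirr.ae_survivesIn_of_recurs hns φ j
      filter_upwards [this] with ω h k j hr _
      exact Or.inr (h j hr)
    · have h1 : (P.law φ).real {ω | ∀ u, ¬ Recurs (levelsUpTo d u) φ ω} = 1 := by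
        rw [← qPartial_eq, hq]
        rfl
      have hm : MeasurableSet {ω : Tree d | ∀ u, ¬ Recurs (levelsUpTo d u) φ ω} := by
        simp only [Set.ofPred_forall]
        exact .iInter fun u => (measurableSet_recurs _ φ).compl
      have h2 : P.law φ {ω | ∀ u, ¬ Recurs (levelsUpTo d u) φ ω} = 1 := by
        rw [← ofReal_measureReal, h1, ENNReal.ofReal_one]
      have h3 : ∀ᵐ ω ∂P.law φ, ω ∈ {ω | ∀ u, ¬ Recurs (levelsUpTo d u) φ ω} :=
        (prob_compl_eq_zero_iff hm).2 h2
      filter_upwards [h3] with ω h k j hr hj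
      exact absurd (hr.mono (Set.singleton_subset_iff.2 hj)) (h k)
  obtain ⟨a, ha⟩ := hA
  filter_upwards [hclass, hback] with ω hclass hback
  constructor
  · intro hnr
    obtain ⟨n, hn⟩ : ∃ n, ∀ w : Line d, n ≤ w.length → Alive ω w → lineType φ w ∉ A := by
      simpa [Recurs] using hnr
    -- The level `k` bounds all individuals before generation `n`; from then on `A` is absent.
    obtain ⟨k, hk⟩ := ((finite_alive ω n).image fun w => (lineType φ w).1).bddAbove
    refine ⟨k, fun l => ⟨fun hs => ?_, fun w hw hwA => ?_⟩⟩
    · obtain ⟨j, -, hj⟩ := (hs.recurs.or_of_union.resolve_left hnr).exists_singleton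
        (finite_levelsUpTo l)
      exact hnr ((hclass j a hj).mono (Set.singleton_subset_iff.2 ha))
    · by_cases hlen : n ≤ w.length
      · exact hn w hlen hw.alive hwA.1
      · exact hwA.2 (hk ⟨w, ⟨not_le.1 hlen, hw.alive⟩, rfl⟩)
  · rintro ⟨k, hk⟩ hr
    -- Each line meets finitely many levels, so it is not cut by the truncation for a suitable `l`.
    have havoid : ∀ w : Line d, Alive ω w → lineType φ w ∉ A ∩ (levelsUpTo d k)ᶜ := by
      intro w hw
      obtain ⟨l, hl⟩ := exists_aliveIn_levelsUpTo φ w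
      exact (hk l).2 w ((hl ω hw).mono Set.subset_union_right)
    have hT : Recurs (levelsUpTo d k) φ ω := by
      intro n
      obtain ⟨w, hn, hw, hwA⟩ := hr n
      exact ⟨w, hn, hw, by_contra fun h => havoid w hw ⟨hwA, h⟩⟩
    obtain ⟨j, hjk, hj⟩ := hT.exists_singleton (finite_levelsUpTo k)
    obtain ⟨b, hb, hbr⟩ | ⟨l, hl⟩ := hback k j hj hjk
    · obtain ⟨w, -, hw, hwb⟩ := hbr 0
      rw [Set.mem_singleton_iff] at hwb
      exact havoid w hw (hwb ▸ hb)
    · exact (hk l).1 (hl.mono Set.subset_union_right)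

lemma truncEvent_subset {C D I J : Set (TypeSet d)} (hCD : C ⊆ D) (hIJ : I ⊆ J) (φ : TypeSet d) :
    truncEvent D J φ ⊆ truncEvent C I φ := fun _ h =>
  ⟨fun hs => h.1 (hs.mono hCD), fun w hw hI => h.2 w (hw.mono hCD) (hIJ hI)⟩

end BlockLHBP

end

/-! ### The two limits, by continuity from above in `l` and from below in `k`. -/

open BlockLHBP in
theorem mainTheorem3 {d : ℕ} (P : BlockLHBP d) (hirr : P.Irreducible)
    (A : Set (TypeSet d)) (hA : A.Nonempty)
    (hrec : A.Infinite ∨ ¬ P.Singular ∨ P.qPartial = 1) :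
    (∀ k l : ℕ, Tendsto (fun n : ℕ => (P.truncG A k l)^[n] 0) atTop (𝓝 (P.truncQ A k l))) ∧
    ∃ L : ℕ → TypeSet d → ℝ,
      (∀ k : ℕ, Tendsto (fun l : ℕ => P.truncQ A k l) atTop (𝓝 (L k))) ∧
      Tendsto L atTop (𝓝 (P.q A)) := by
  refine ⟨tendsto_truncG_iterate P A, fun k φ => (P.law φ).real
    (⋂ l, truncEvent (A ∪ levelsUpTo d l) (A ∩ (levelsUpTo d k)ᶜ) φ), fun k => ?_, ?_⟩
  · refine tendsto_pi_nhds.2 fun φ => ?_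
    simp only [truncQ_eq]
    refine (ENNReal.tendsto_toReal (measure_ne_top _ _)).comp (tendsto_measure_iInter_atTop
      (fun l => (measurableSet_truncEvent _ _ φ).nullMeasurableSet) ?_ ⟨0, measure_ne_top _ _⟩)
    exact fun l l' h => truncEvent_subset (Set.union_subset_union_right A (levelsUpTo_mono h))
      subset_rfl φ
  · refine tendsto_pi_nhds.2 fun φ => ?_
    have hq : P.q A φ = (P.law φ).real
        (⋃ k, ⋂ l, truncEvent (A ∪ levelsUpTo d l) (A ∩ (levelsUpTo d k)ᶜ) φ) := by
      rw [q_eq]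
      refine measureReal_congr ?_
      filter_upwards [ae_not_recurs_iff hirr hA hrec φ] with ω hω
      refine propext (Iff.trans hω ?_)
      change _ ↔ ω ∈ ⋃ k, _
      simp only [Set.mem_iUnion, Set.mem_iInter]
    rw [hq]
    refine (ENNReal.tendsto_toReal (measure_ne_top _ _)).comp (tendsto_measure_iUnion_atTop ?_)
    exact fun k k' h => Set.iInter_mono fun l => truncEvent_subset subset_rfl
      (Set.inter_subset_inter_right A (Set.compl_subset_compl.2 (levelsUpTo_mono h))) φ
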